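/- Let $\gamma>\frac12$ with $2\gamma\notin\mathbb N$. For $\lambda\in\mathbb C$ consider the model equation $$(-s^2\partial_s^2+\gamma(\gamma+1)+is^3)f=\lambda s^2 f,\qquad s\in(0,\infty). \tag{1}$$ For $\delta\in\{-\gamma,\gamma+1\}$ define $g_0=1$, $g_1=0$, $g_{-1}=0$ and $g_{n+2}=\dfrac{-\lambda g_n+i g_{n-1}}{(n+2)(n+1+2\delta)}$ for $n\ge 0$; let $F_{+,\lambda}(s)=\sum_{n\ge0}g_ns^n$ be the entire function obtained with $\delta=-\gamma$, and $F_{-,\lambda}(s)=\sum_{n\ge0}g_ns^n$ the one obtained with $\delta=\gamma+1$. Let $\mathrm{Ai}(z)=\frac1{2\pi}\int_{\operatorname{Im}w=1}e^{i(w^3/3+zw)}\,dw$ be the (entire) Airy function and put $G_\lambda(s)=\mathrm{Ai}\big(e^{i\pi/6}(s+i\lambda)\big)$. Then there are $\lambda_0>0$ and $s_0>0$ (depending only on $\gamma$) such that for every $\lambda\in\mathbb C$ with $|\lambda|\le\lambda_0$ the following holds. (i) There is exactly one solution $H_\lambda$ of (1) on $(0,\infty)$ such that $\int_1^\infty|H_\lambda(s)|^2\,ds<\infty$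 and, for some constant $d(\lambda)\in\mathbb C$, $$H_\lambda(s)=s^{-\gamma}F_{+,\lambda}(s)+d(\lambda)\,s^{\gamma+1}F_{-,\lambda}(s)\qquad\text{for all } s>0;$$ the constant $d(\lambda)$ is also unique. (ii) $G_\lambda$ has no zero on $[s_0,\infty)$; there is exactly one $R_\lambda\in L^\infty([s_0,\infty))$ (up to equality almost everywhere) with $$R_\lambda(s)=\int_s^\infty\Big[\int_s^z\frac{G_\lambda^2(z)}{G_\lambda^2(u)}\,du\Big]\frac{\gamma(\gamma+1)}{z^2}\,\big(1+R_\lambda(z)\big)\,dz\qquad\text{for a.e. } s\ge s_0,$$ the outer integral being absolutely convergent; and there is a constant $C_\lambda\ne0$ such that, for a suitable representative of $R_\lambda$, $$H_\lambda(s)=C_\lambda\,\mathrm{Ai}\big(e^{i\pi/6}(s+i\lambda)\big)\,\big(1+R_\lambda(s)\big)\qquad\text{for all } s\ge s_0.$$ -/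

import Mathlib

open Complex MeasureTheory Set

noncomputable section

namespace FokkerPlanckAiry

/-- `f` is a (classical) solution on `(0, ∞)` of
`(- s² ∂ₛ² + γ (γ + 1) + i s³) f = lam s² f`. Values of `f` outside `(0, ∞)` play no role. -/
def IsModelSolution (γ : ℝ) (lam : ℂ) (f : ℝ → ℂ) : Prop :=
  ∀ s : ℝ, 0 < s →
    DifferentiableAt ℝ f s ∧ DifferentiableAt ℝ (deriv f) s ∧
    -(s : ℂ) ^ 2 * deriv (deriv f) s + (γ : ℂ) * ((γ : ℂ) + 1) * f s + I * (s : ℂ) ^ 3 * f s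
      = lam * (s : ℂ) ^ 2 * f s

/-- The coefficients `g₀ = 1`, `g₁ = 0`,
`gₙ₊₂ = (- lam gₙ + i gₙ₋₁) / ((n + 2) (n + 1 + 2 δ))` for `n ≥ 0`, with `g₋₁ = 0`. -/
def frobeniusCoeff (δ : ℝ) (lam : ℂ) : ℕ → ℂ
  | 0 => 1
  | 1 => 0
  | 2 => (-lam * frobeniusCoeff δ lam 0) / (2 * (1 + 2 * (δ : ℂ)))
  | n + 3 => (-lam * frobeniusCoeff δ lam (n + 1) + I * frobeniusCoeff δ lam n)
      / (((n : ℂ) + 3) * ((n : ℂ) + 2 + 2 * (δ : ℂ)))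

/-- The power series `∑ gₙ sⁿ`; it converges for every complex `s`, see
`frobeniusCoeff_summable`. -/
def frobeniusSeries (δ : ℝ) (lam : ℂ) (s : ℂ) : ℂ :=
  ∑' n : ℕ, frobeniusCoeff δ lam n * s ^ n

/-- `F_{+,lam}`: the exponent is `δ = - γ`. -/
def Fplus (γ : ℝ) (lam : ℂ) (s : ℂ) : ℂ := frobeniusSeries (-γ) lam s

/-- `F_{-,lam}`: the exponent is `δ = γ + 1`. -/
def Fminus (γ : ℝ) (lam : ℂ) (s : ℂ) : ℂ := frobeniusSeries (γ + 1) lam s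

/-- `H` solves the model equation on `(0, ∞)`, is square-integrable on `[1, ∞)`, and
`H(s) = s^{-γ} F_{+,lam}(s) + c s^{γ+1} F_{-,lam}(s)` for all `s > 0`. -/
structure IsNormalizedL2Solution (γ : ℝ) (lam : ℂ) (H : ℝ → ℂ) (c : ℂ) : Prop where
  solution : IsModelSolution γ lam H
  sq_integrable : IntegrableOn (fun s : ℝ => ‖H s‖ ^ 2) (Ici 1) volume
  expansion : ∀ s : ℝ, 0 < s →
    H s = ((s ^ (-γ) : ℝ) : ℂ) * Fplus γ lam s + c * ((s ^ (γ + 1) : ℝ) : ℂ) * Fminus γ lam s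

/-- The integrand `exp (i (w³ / 3 + z w))` of the Airy integral on the line `w = t + i`. -/
def airyIntegrand (z : ℂ) (t : ℝ) : ℂ :=
  exp (I * (((t : ℂ) + I) ^ 3 / 3 + z * ((t : ℂ) + I)))

/-- The Airy function as an entire function. The integral
`(1 / 2π) ∫ exp (i (w³ / 3 + z w)) dw` converges only conditionally on the real line for real `z`
and diverges there for non-real `z`; on the line `Im w = 1` it converges absolutely for every
complex `z` (see `airyIntegrand_integrable`), and gives the entire extension. -/
def Ai (z : ℂ) : ℂ := (1 / (2 * (Real.pi : ℂ))) * ∫ t : ℝ, airyIntegrand z t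

/-- `G_lam(s) = Ai (e^{iπ/6} (s + i lam))`. -/
def airyG (lam : ℂ) (s : ℝ) : ℂ :=
  Ai (exp (I * ((Real.pi / 6 : ℝ) : ℂ)) * ((s : ℂ) + I * lam))

/-- `(∫ₛᶻ G_lam(z)² / G_lam(u)² du) γ (γ + 1) / z²`. -/
def volterraKernel (γ : ℝ) (lam : ℂ) (s z : ℝ) : ℂ :=
  (∫ u in s..z, airyG lam z ^ 2 / airyG lam u ^ 2) * ((γ * (γ + 1) / z ^ 2 : ℝ) : ℂ)

/-- `R ∈ L^∞([s₀, ∞))` satisfies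
`R(s) = ∫ₛ^∞ (∫ₛᶻ G_lam(z)² / G_lam(u)² du) γ (γ + 1) / z² (1 + R(z)) dz` almost everywhere
on `[s₀, ∞)`, where the outer integral converges absolutely. -/
structure IsVolterraFixedPoint (γ : ℝ) (lam : ℂ) (s₀ : ℝ) (R : ℝ → ℂ) : Prop where
  bounded : MemLp R ⊤ (volume.restrict (Ici s₀))
  fixed : ∀ᵐ s ∂(volume.restrict (Ici s₀)),
    IntegrableOn (fun z : ℝ => volterraKernel γ lam s z * (1 + R z)) (Ioi s) volume ∧
    R s = ∫ z in Ioi s, volterraKernel γ lam s z * (1 + R z)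

theorem frobeniusCoeff_summable (δ : ℝ) (lam s : ℂ) :
    Summable fun n : ℕ => frobeniusCoeff δ lam n * s ^ n := by
  set r : ℝ := ‖s‖ + 1 with hr
  have hr0 : 0 < r := by positivity
  set c := frobeniusCoeff δ lam with hc
  obtain ⟨N, hN⟩ := exists_nat_ge (‖lam‖ * r ^ 2 + r ^ 3 + 2 * |δ|)
  have hb : ∀ n, ‖c n‖ * r ^ n ≤ ∑ k ∈ Finset.range (N + 3), ‖c k‖ * r ^ k := by
    intro n
    induction n using Nat.strong_induction_on with
    | _ n ih =>
      rcases lt_or_ge n (N + 3) with h | h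
      · exact Finset.single_le_sum (f := fun k => ‖c k‖ * r ^ k)
          (fun i _ => by positivity) (Finset.mem_range.2 h)
      · obtain ⟨m, rfl⟩ : ∃ m, n = m + 3 := ⟨n - 3, by omega⟩
        have hm : (N : ℝ) ≤ m := by exact_mod_cast (by omega : N ≤ m)
        have h1 := ih (m + 1) (by omega)
        have h2 := ih m (by omega)
        set M := ∑ k ∈ Finset.range (N + 3), ‖c k‖ * r ^ k
        have hδ := neg_abs_le δ
        have hδ0 := abs_nonneg δ
        have hA : 0 ≤ ‖lam‖ * r ^ 2 + r ^ 3 := by positivity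
        have hq : ‖lam‖ * r ^ 2 + r ^ 3 ≤ (m : ℝ) + 2 + 2 * δ := by linarith
        have hq' : 1 ≤ (m : ℝ) + 2 + 2 * δ := by linarith
        have hnorm : ‖(((m : ℂ) + 3) * ((m : ℂ) + 2 + 2 * (δ : ℂ)))‖
            = ((m : ℝ) + 3) * ((m : ℝ) + 2 + 2 * δ) := by
          have : (((m : ℂ) + 3) * ((m : ℂ) + 2 + 2 * (δ : ℂ)))
              = ((((m : ℝ) + 3) * ((m : ℝ) + 2 + 2 * δ) : ℝ) : ℂ) := by push_cast; ring
          rw [this, Complex.norm_real, Real.norm_of_nonneg (by positivity)]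
        have hD : 0 < ((m : ℝ) + 3) * ((m : ℝ) + 2 + 2 * δ) := by positivity
        have hrec : c (m + 3) = (-lam * c (m + 1) + I * c m)
            / (((m : ℂ) + 3) * ((m : ℂ) + 2 + 2 * (δ : ℂ))) := by
          simp only [hc, frobeniusCoeff]
        have hnum : ‖-lam * c (m + 1) + I * c m‖ ≤ ‖lam‖ * ‖c (m + 1)‖ + ‖c m‖ := by
          refine (norm_add_le _ _).trans ?_
          simp
        have hM : 0 ≤ M := le_trans (by positivity) h2
        rw [hrec, norm_div, hnorm, div_mul_eq_mul_div, div_le_iff₀ hD]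
        calc ‖-lam * c (m + 1) + I * c m‖ * r ^ (m + 3)
            ≤ (‖lam‖ * ‖c (m + 1)‖ + ‖c m‖) * r ^ (m + 3) := by gcongr
          _ = ‖lam‖ * r ^ 2 * (‖c (m + 1)‖ * r ^ (m + 1)) + r ^ 3 * (‖c m‖ * r ^ m) := by ring
          _ ≤ ‖lam‖ * r ^ 2 * M + r ^ 3 * M := by gcongr
          _ = M * (‖lam‖ * r ^ 2 + r ^ 3) := by ring
          _ ≤ M * (((m : ℝ) + 3) * ((m : ℝ) + 2 + 2 * δ)) := by
              gcongr
              have : (0 : ℝ) ≤ m := Nat.cast_nonneg m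
              nlinarith
  set M := ∑ k ∈ Finset.range (N + 3), ‖c k‖ * r ^ k
  have hlt : ‖s‖ / r < 1 := by rw [div_lt_one hr0]; linarith
  refine Summable.of_norm_bounded
    ((summable_geometric_of_lt_one (by positivity) hlt).mul_left M) fun n => ?_
  have h := hb n
  rw [norm_mul, norm_pow, div_pow]
  calc ‖c n‖ * ‖s‖ ^ n = (‖c n‖ * r ^ n) * (‖s‖ ^ n / r ^ n) := by field_simp
    _ ≤ M * (‖s‖ ^ n / r ^ n) := by gcongr

theorem airyIntegrand_integrable (z : ℂ) : Integrable (airyIntegrand z) := by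
  have h : airyIntegrand z = fun t : ℝ =>
      exp (I * ((t : ℂ) ^ 3 / 3)) *
        exp (-1 * (t : ℂ) ^ 2 + (I * (z - 1)) * (t : ℂ) + (1 / 3 - z)) := by
    funext t
    rw [airyIntegrand, ← Complex.exp_add]
    congr 1
    have hI : I ^ 2 = -1 := I_sq
    have hI3 : I ^ 3 = -I := by rw [pow_succ, hI]; ring
    have hI4 : I ^ 4 = 1 := I_pow_four
    ring_nf
    simp only [hI, hI3, hI4]
    ring
  rw [h]
  have hg := integrable_cexp_quadratic' (b := -1) (by simp) (I * (z - 1)) (1 / 3 - z)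
  have hf : Continuous fun t : ℝ => exp (I * ((t : ℂ) ^ 3 / 3)) := by fun_prop
  refine hg.bdd_mul (c := 1) hf.aestronglyMeasurable (Filter.Eventually.of_forall fun t => ?_)
  have h1 : I * ((t : ℂ) ^ 3 / 3) = ((t ^ 3 / 3 : ℝ) : ℂ) * I := by push_cast; ring
  rw [h1, Complex.norm_exp_ofReal_mul_I]

end FokkerPlanckAiry

end

open Complex MeasureTheory Set

noncomputable section

namespace FokkerPlanckAiry

/-! Divided by $-s^2$, the model equation reads $f''=(\gamma(\gamma+1)/s^2+is-\lambda)f$. Without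
the inverse-square term it is solved by $G(s)=\mathrm{Ai}(e^{i\pi/6}(s+i\lambda))$, because
$(e^{i\pi/6})^3=i$. Near infinity the inverse-square term is a small perturbation, so a decaying
solution is sought as $Gy$. Then $(G^2y')'=\gamma(\gamma+1)s^{-2}G^2y$, and two integrations from
infinity give the Volterra equation for $R=y-1$, a contraction for large $s$.

The analytic input is that $G$ has no zero for large $s$ and that $|G|^2e^s$ is nonincreasing there.
Both come from a quadratic energy in $(G,G')$ (`airyEnergy_deriv_bound`) that is nondecreasing and
tends to zero, hence is nonpositive. No Airy asymptotics are needed: shifting the contour gives a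
crude exponential bound, and Fourier inversion shows that $\mathrm{Ai}\not\equiv0$.

At the origin the Frobenius solutions $s^{-\gamma}F_+$ and $s^{\gamma+1}F_-$ have Wronskian
$2\gamma+1$, so $Gy=\alpha s^{-\gamma}F_++\beta s^{\gamma+1}F_-$. If $\alpha$ were $0$, then
$s^{\gamma+1}F_-$ would vanish at both ends, with its derivative. The monotone quantity
$\mathrm{Re}((1-i)\bar f f')$ excludes this for small $\lambda$ (`model_solution_eq_zero`). Hence
$\alpha\ne0$, and $H=\alpha^{-1}Gy$, $d=\beta/\alpha$, $C=\alpha^{-1}$.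

Uniqueness of $H$ and $d$ holds because a solution with nonzero Wronskian against the decaying one
is not square-integrable (`not_sq_integrableOn_of_wronskian_ne_zero`). Uniqueness of $R$ is the same
contraction estimate in $L^\infty$. -/

/-! ### The Airy function -/

/-- The Airy integrand on the line `Im w = η`. -/
def airyLine (z : ℂ) (η t : ℝ) : ℂ :=
  exp (I * (((t : ℂ) + η * I) ^ 3 / 3 + z * ((t : ℂ) + η * I)))

theorem airyLine_one (z : ℂ) : airyLine z 1 = airyIntegrand z := by
  funext t; simp [airyLine, airyIntegrand]

/-- The factor $e^{-\eta t^2}$, produced by the cubic on a shifted line, is the source of all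
absolute convergence below. -/
theorem norm_airyLine (z : ℂ) (η t : ℝ) :
    ‖airyLine z η t‖ = Real.exp (η ^ 3 / 3 - η * t ^ 2 - η * z.re - t * z.im) := by
  have h : I * (((t : ℂ) + η * I) ^ 3 / 3 + z * ((t : ℂ) + η * I))
      = ((η ^ 3 / 3 - η * t ^ 2 - η * z.re - t * z.im : ℝ) : ℂ)
        + ((t ^ 3 / 3 - η ^ 2 * t + z.re * t - η * z.im : ℝ) : ℂ) * I := by
    conv_lhs => rw [← Complex.re_add_im z]
    push_cast
    linear_combination ((t : ℂ) ^ 2 * η + z.re * η + z.im * t + I * (t * η ^ 2 + z.im * η)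
      + (I ^ 2 - 1) * η ^ 3 / 3) * I_sq
  rw [airyLine, h, Complex.exp_add, norm_mul, Complex.norm_exp_ofReal_mul_I, mul_one,
    ← Complex.ofReal_exp, Complex.norm_real, Real.norm_of_nonneg (Real.exp_pos _).le]

theorem continuous_airyLine (z : ℂ) (η : ℝ) : Continuous (airyLine z η) := by
  unfold airyLine; fun_prop

theorem integrable_exp_quadratic_abs {b : ℝ} (hb : 0 < b) (M C : ℝ) :
    Integrable fun t : ℝ => Real.exp (C - b * t ^ 2 + M * |t|) := by
  refine ((integrable_exp_neg_mul_sq (half_pos hb)).const_mul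
    (Real.exp (C + M ^ 2 / (2 * b)))).mono' (by fun_prop) (Filter.Eventually.of_forall fun t => ?_)
  rw [Real.norm_of_nonneg (Real.exp_pos _).le, ← Real.exp_add, Real.exp_le_exp]
  have h1 : 0 ≤ (b * |t| - M) ^ 2 / (2 * b) := by positivity
  have h2 : (b * |t| - M) ^ 2 / (2 * b) = b / 2 * t ^ 2 - M * |t| + M ^ 2 / (2 * b) := by
    rw [← sq_abs t]; field_simp; ring
  linarith

theorem abs_add_le_exp {c : ℝ} (hc : 0 ≤ c) (t : ℝ) : |t| + c ≤ (1 + c) * Real.exp |t| := by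
  have h := Real.add_one_le_exp |t|
  have h0 := abs_nonneg t
  nlinarith

theorem norm_linePoint_le {c η : ℝ} (hη : |η| ≤ c) (t : ℝ) :
    ‖(t : ℂ) + η * I‖ ≤ (1 + c) * Real.exp |t| := by
  refine le_trans ?_ (abs_add_le_exp ((abs_nonneg η).trans hη) t)
  refine (norm_add_le _ _).trans ?_
  simpa using hη

/-- The integrals `∫ (i w)ᵏ exp (i (w³ / 3 + z w)) dw` over the line `Im w = 1`. -/
def airyMoment (k : ℕ) (z : ℂ) : ℂ :=
  ∫ t : ℝ, (I * ((t : ℂ) + (1 : ℝ) * I)) ^ k * airyLine z 1 t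

/-- One majorant, uniform for $\eta\in[b,c]$ and $\|z\|\le M$, that serves to differentiate under
the integral both in $z$ and in $\eta$. Powers of $w$ are absorbed into $e^{k|t|}$. -/
theorem norm_moment_le (k : ℕ) {z : ℂ} {M : ℝ} (hz : ‖z‖ ≤ M) {b c η : ℝ} (hb : b ≤ η)
    (hη : η ≤ c) (hb0 : 0 ≤ b) (t : ℝ) :
    ‖(I * ((t : ℂ) + η * I)) ^ k * airyLine z η t‖
      ≤ (1 + c) ^ k * Real.exp (c ^ 3 / 3 + c * M - b * t ^ 2 + (k + M) * |t|) := by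
  have hη0 : 0 ≤ η := hb0.trans hb
  have hM : 0 ≤ M := (norm_nonneg z).trans hz
  rw [norm_mul, norm_pow, norm_mul, norm_I, one_mul, norm_airyLine]
  have h1 := norm_linePoint_le (c := c) (by rwa [abs_of_nonneg hη0]) t
  calc ‖(t : ℂ) + η * I‖ ^ k * Real.exp (η ^ 3 / 3 - η * t ^ 2 - η * z.re - t * z.im)
      ≤ ((1 + c) * Real.exp |t|) ^ k * Real.exp (c ^ 3 / 3 - b * t ^ 2 + c * M + |t| * M) := by
        have h2 : η ^ 3 ≤ c ^ 3 := by gcongr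
        have h3 : b * t ^ 2 ≤ η * t ^ 2 := by gcongr
        have h4 : -(η * z.re) ≤ c * M := by
          have : -z.re ≤ M := (neg_le_abs _).trans ((abs_re_le_norm z).trans hz)
          calc -(η * z.re) = η * (-z.re) := by ring
            _ ≤ η * M := by gcongr
            _ ≤ c * M := by gcongr
        have h5 : -(t * z.im) ≤ |t| * M := by
          refine (neg_le_abs _).trans ?_
          rw [abs_mul]
          gcongr
          exact (abs_im_le_norm z).trans hz
        have h6 := hη0.trans hη
        gcongr
        linarith
    _ = _ := by
        rw [mul_pow, ← Real.exp_nat_mul, mul_assoc, ← Real.exp_add]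
        congr 2
        ring

theorem continuous_moment (k : ℕ) (z : ℂ) (η : ℝ) :
    Continuous fun t : ℝ => (I * ((t : ℂ) + η * I)) ^ k * airyLine z η t := by
  have := continuous_airyLine z η
  fun_prop

theorem integrable_moment (k : ℕ) (z : ℂ) {η : ℝ} (hη : 0 < η) :
    Integrable fun t : ℝ => (I * ((t : ℂ) + η * I)) ^ k * airyLine z η t :=
  ((integrable_exp_quadratic_abs hη _ _).const_mul _).mono'
    (continuous_moment k z η).aestronglyMeasurable
    (Filter.Eventually.of_forall fun t => norm_moment_le k le_rfl le_rfl le_rfl hη.le t)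

theorem hasDerivAt_airyMoment (k : ℕ) (z : ℂ) :
    HasDerivAt (airyMoment k) (airyMoment (k + 1) z) z := by
  refine (hasDerivAt_integral_of_dominated_loc_of_deriv_le (Metric.ball_mem_nhds z one_pos)
    (bound := fun t => (1 + 1) ^ (k + 1) * Real.exp (1 ^ 3 / 3 + 1 * (‖z‖ + 1) - 1 * t ^ 2
      + ((k + 1 : ℕ) + (‖z‖ + 1)) * |t|))
    (F' := fun z t => (I * ((t : ℂ) + (1 : ℝ) * I)) ^ (k + 1) * airyLine z 1 t)
    (Filter.Eventually.of_forall fun z => (continuous_moment k z 1).aestronglyMeasurable)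
    (integrable_moment k z one_pos) (continuous_moment (k + 1) z 1).aestronglyMeasurable
    (Filter.Eventually.of_forall fun t x hx => norm_moment_le (k + 1) ?_ le_rfl le_rfl
      zero_le_one t)
    ((integrable_exp_quadratic_abs one_pos _ _).const_mul _)
    (Filter.Eventually.of_forall fun t x _ => ?_)).2
  · have := norm_sub_norm_le x z
    rw [Metric.mem_ball, dist_eq_norm] at hx
    linarith
  · have h : HasDerivAt (fun x : ℂ => I * (((t : ℂ) + (1 : ℝ) * I) ^ 3 / 3
        + x * ((t : ℂ) + (1 : ℝ) * I))) (I * (1 * ((t : ℂ) + (1 : ℝ) * I))) x :=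
      (((hasDerivAt_id x).mul_const _).const_add _).const_mul _
    refine (h.cexp.const_mul ((I * ((t : ℂ) + (1 : ℝ) * I)) ^ k)).congr_deriv ?_
    simp only [airyLine]
    ring

/-- The integral of a total derivative along `Im w = η` vanishes. -/
theorem integral_airyLine_total_deriv (z : ℂ) {η : ℝ} (hη : 0 < η) :
    ∫ t : ℝ, (((t : ℂ) + η * I) ^ 2 + z) * airyLine z η t = 0 := by
  have hint : Integrable fun t : ℝ => (((t : ℂ) + η * I) ^ 2 + z) * airyLine z η t := by
    refine (((integrable_moment 2 z hη).const_mul (-1)).add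
      ((integrable_moment 0 z hη).const_mul z)).congr (Filter.Eventually.of_forall fun t => ?_)
    simp only [Pi.add_apply, mul_pow, I_sq]
    ring
  have h := integral_eq_zero_of_hasDerivAt_of_integrable (f := airyLine z η)
    (f' := fun t => I * ((((t : ℂ) + η * I) ^ 2 + z) * airyLine z η t)) (fun t => ?_)
    (hint.const_mul I) (by simpa using integrable_moment 0 z hη)
  · rw [integral_const_mul] at h
    simpa using h
  · have h1 : HasDerivAt (fun t : ℝ => (t : ℂ) + η * I) 1 t :=
      (hasDerivAt_id t).ofReal_comp.add_const _
    have h2 := ((((h1.pow 3).div_const 3).add (h1.const_mul z)).const_mul I).cexp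
    refine h2.congr_deriv ?_
    simp only [airyLine, Pi.add_apply, Pi.pow_apply]
    push_cast
    ring

/-- Infinitesimal form of Cauchy's theorem: the integrand is holomorphic in $w=t+i\eta$, so its
$\eta$-derivative is $i$ times its $t$-derivative, which integrates to zero. -/
theorem hasDerivAt_integral_airyLine (z : ℂ) {η : ℝ} (hη : 0 < η) :
    HasDerivAt (fun η : ℝ => ∫ t : ℝ, airyLine z η t) 0 η := by
  have key := (hasDerivAt_integral_of_dominated_loc_of_deriv_le
    (Metric.ball_mem_nhds η (half_pos hη)) (F := fun η t => airyLine z η t)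
    (bound := fun t => (1 + 2 * η) ^ 2 * Real.exp ((2 * η) ^ 3 / 3 + 2 * η * ‖z‖
        - η / 2 * t ^ 2 + ((2 : ℕ) + ‖z‖) * |t|) + ‖z‖ * ((1 + 2 * η) ^ 0 *
        Real.exp ((2 * η) ^ 3 / 3 + 2 * η * ‖z‖ - η / 2 * t ^ 2 + ((0 : ℕ) + ‖z‖) * |t|)))
    (F' := fun η t => -1 * ((((t : ℂ) + η * I) ^ 2 + z) * airyLine z η t))
    (Filter.Eventually.of_forall fun η => (continuous_airyLine z η).aestronglyMeasurable)
    (by simpa using integrable_moment 0 z hη)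
    (by have := continuous_airyLine z η
        exact Continuous.aestronglyMeasurable (by fun_prop))
    (Filter.Eventually.of_forall fun t x hx => ?_)
    (((integrable_exp_quadratic_abs (half_pos hη) _ _).const_mul _).add
      (((integrable_exp_quadratic_abs (half_pos hη) _ _).const_mul _).const_mul _))
    (Filter.Eventually.of_forall fun t x _ => ?_)).2
  · refine key.congr_deriv ?_
    rw [integral_const_mul, integral_airyLine_total_deriv z hη, mul_zero]
  · rw [Metric.mem_ball, Real.dist_eq, abs_lt] at hx
    have h2 := norm_moment_le 2 (le_refl ‖z‖) (b := η / 2) (c := 2 * η) (η := x) (by linarith)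
      (by linarith) (by linarith) t
    have h0 := norm_moment_le 0 (le_refl ‖z‖) (b := η / 2) (c := 2 * η) (η := x) (by linarith)
      (by linarith) (by linarith) t
    have e : -1 * ((((t : ℂ) + x * I) ^ 2 + z) * airyLine z x t)
        = (I * ((t : ℂ) + x * I)) ^ 2 * airyLine z x t
          + -z * ((I * ((t : ℂ) + x * I)) ^ 0 * airyLine z x t) := by
      rw [mul_pow, I_sq]; ring
    rw [e]
    refine (norm_add_le _ _).trans (add_le_add h2 ?_)
    rw [norm_mul, norm_neg]
    gcongr
  · have h1 : HasDerivAt (fun x : ℝ => (t : ℂ) + x * I) (1 * I) x :=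
      ((hasDerivAt_id x).ofReal_comp.mul_const I).const_add _
    have h2 := ((((h1.pow 3).div_const 3).add (h1.const_mul z)).const_mul I).cexp
    refine h2.congr_deriv ?_
    simp only [airyLine, Pi.add_apply, Pi.pow_apply]
    push_cast
    linear_combination (exp (I * (((t : ℂ) + x * I) ^ 3 / 3 + z * ((t : ℂ) + x * I)))
      * (((t : ℂ) + x * I) ^ 2 + z)) * I_sq

theorem Ai_eq_integral_airyLine (z : ℂ) {η : ℝ} (hη : 0 < η) :
    Ai z = (1 / (2 * (Real.pi : ℂ))) * ∫ t : ℝ, airyLine z η t := by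
  rw [Ai, ← airyLine_one]
  congr 1
  exact isOpen_Ioi.is_const_of_deriv_eq_zero isPreconnected_Ioi
    (f := fun η : ℝ => ∫ t : ℝ, airyLine z η t) (s := Ioi 0)
    (fun x hx => (hasDerivAt_integral_airyLine z hx).differentiableAt.differentiableWithinAt)
    (fun x hx => (hasDerivAt_integral_airyLine z hx).deriv) (mem_Ioi.2 one_pos) hη

theorem Ai_eq_moment : Ai = fun z => (1 / (2 * (Real.pi : ℂ))) * airyMoment 0 z := by
  funext z
  simp [Ai_eq_integral_airyLine z one_pos, airyMoment]

/-- The derivative of the Airy function. -/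
def AiDeriv (z : ℂ) : ℂ := (1 / (2 * (Real.pi : ℂ))) * airyMoment 1 z

theorem hasDerivAt_Ai (z : ℂ) : HasDerivAt Ai (AiDeriv z) z := by
  rw [Ai_eq_moment]
  exact (hasDerivAt_airyMoment 0 z).const_mul _

/-- The Airy equation `Ai'' = z Ai`. -/
theorem hasDerivAt_AiDeriv (z : ℂ) : HasDerivAt AiDeriv (z * Ai z) z := by
  refine ((hasDerivAt_airyMoment 1 z).const_mul (1 / (2 * (Real.pi : ℂ)))).congr_deriv ?_
  rw [Ai_eq_integral_airyLine z one_pos, mul_left_comm]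
  congr 1
  have h := integral_airyLine_total_deriv z one_pos
  have h2 := integrable_moment 2 z one_pos
  have h0 : Integrable (airyLine z 1) := by simpa using integrable_moment 0 z one_pos
  have e : (fun t : ℝ => (((t : ℂ) + (1 : ℝ) * I) ^ 2 + z) * airyLine z 1 t)
      = fun t : ℝ => z * airyLine z 1 t
        - (I * ((t : ℂ) + (1 : ℝ) * I)) ^ 2 * airyLine z 1 t := by
    funext t; rw [mul_pow, I_sq]; ring
  rw [e, integral_sub (h0.const_mul z) h2, integral_const_mul, sub_eq_zero] at h
  rw [airyMoment, h]

/-- On each line the modulus of the integrand is a Gaussian centred at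
$-\operatorname{Im}z/(2\eta)$, so its integral is explicit. The height $\eta$ stays free for
optimisation. -/
theorem norm_Ai_le (z : ℂ) {η : ℝ} (hη : 1 ≤ η) :
    ‖Ai z‖ ≤ Real.exp (η ^ 3 / 3 - η * z.re + z.im ^ 2 / (4 * η)) := by
  have hη0 : 0 < η := by linarith
  have hpi := Real.pi_gt_three
  rw [Ai_eq_integral_airyLine z hη0, norm_mul]
  have h1 : ‖∫ t : ℝ, airyLine z η t‖
      ≤ Real.exp (η ^ 3 / 3 - η * z.re + z.im ^ 2 / (4 * η)) * √(Real.pi / η) := by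
    rw [← integral_gaussian η, ← integral_add_right_eq_self
      (fun x : ℝ => Real.exp (-η * x ^ 2)) (z.im / (2 * η)), ← integral_const_mul]
    refine (norm_integral_le_integral_norm _).trans_eq ?_
    congr 1
    funext t
    rw [norm_airyLine, ← Real.exp_add]
    congr 1
    field_simp
    ring
  have h2 : √(Real.pi / η) ≤ Real.pi := by
    rw [Real.sqrt_le_left (by linarith), div_le_iff₀ hη0]
    nlinarith
  have h3 : ‖1 / (2 * (Real.pi : ℂ))‖ = 1 / (2 * Real.pi) := by
    simp [abs_of_pos Real.pi_pos]
  rw [h3]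
  set A := Real.exp (η ^ 3 / 3 - η * z.re + z.im ^ 2 / (4 * η)) with hA
  have hA0 : 0 < A := Real.exp_pos _
  calc 1 / (2 * Real.pi) * ‖∫ t : ℝ, airyLine z η t‖
      ≤ 1 / (2 * Real.pi) * (A * Real.pi) := by gcongr; exact h1.trans (by gcongr)
    _ = A / 2 := by field_simp
    _ ≤ A := by linarith

/-- The direction `e^{iπ/6}` of the ray on which the model equation is an Airy equation. -/
def airyDir : ℂ := exp (I * ((Real.pi / 6 : ℝ) : ℂ))

theorem airyDir_eq : airyDir = ((√3 / 2 : ℝ) : ℂ) + ((1 / 2 : ℝ) : ℂ) * I := by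
  rw [airyDir, mul_comm, Complex.exp_mul_I, ← Complex.ofReal_cos, ← Complex.ofReal_sin,
    Real.cos_pi_div_six, Real.sin_pi_div_six]

theorem norm_airyDir : ‖airyDir‖ = 1 := by
  rw [airyDir, mul_comm, Complex.norm_exp_ofReal_mul_I]

theorem airyDir_pow_three : airyDir ^ 3 = I := by
  rw [airyDir, ← Complex.exp_nat_mul]
  convert Complex.exp_pi_div_two_mul_I using 2
  push_cast
  ring

/-! ### Decay and nontriviality of the Airy function on the ray -/

theorem norm_Ai_le_near_ray {s : ℝ} (hs : 1 ≤ s) {z : ℂ} (hz : ‖z - airyDir * s‖ ≤ 2) :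
    ‖Ai z‖ ≤ Real.exp (7 - s) := by
  -- The height $\sqrt s$ is close to that of the saddle point $i\sqrt z$. The exponent is then
  -- about $(1/3-\sqrt3/2+1/16)s^{3/2}<0$, and the constant $7$ absorbs the lower-order terms.
  set r := √s with hr
  have hr1 : 1 ≤ r := Real.one_le_sqrt.2 hs
  have hrs : r ^ 2 = s := Real.sq_sqrt (by linarith)
  refine (norm_Ai_le z hr1).trans (Real.exp_le_exp.2 ?_)
  have e1 : (z - airyDir * s).re = z.re - √3 / 2 * s := by
    rw [airyDir_eq]; simp
  have e2 : (z - airyDir * s).im = z.im - 1 / 2 * s := by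
    rw [airyDir_eq]; simp
  have h1 := abs_le.1 ((abs_re_le_norm _).trans hz)
  have h2 := abs_le.1 ((abs_im_le_norm _).trans hz)
  rw [e1] at h1
  rw [e2] at h2
  have h3 : (1.73 : ℝ) ≤ √3 := Real.le_sqrt_of_sq_le (by norm_num)
  have hre : 0.86 * r ^ 2 - 2 ≤ z.re := by
    rw [hrs]; nlinarith [h1.1]
  have him : z.im ^ 2 ≤ (r ^ 2 / 2 + 2) ^ 2 := by
    rw [hrs]; apply sq_le_sq'
    · linarith [h2.1]
    · linarith [h2.2]
  have him' : z.im ^ 2 / (4 * r) ≤ r ^ 3 / 16 + r / 2 + 1 := by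
    rw [div_le_iff₀ (by positivity)]
    nlinarith
  have hre' : r * (0.86 * r ^ 2 - 2) ≤ r * z.re := by gcongr
  rw [← hrs]
  nlinarith [mul_nonneg (by linarith : (0 : ℝ) ≤ r) (sq_nonneg (r - 2.25)), sq_nonneg (r - 2.25)]

/-- Cauchy's estimate on the unit circle around $z$; this is why the preceding bound allows distance
$2$ from the ray. -/
theorem norm_AiDeriv_le_near_ray {s : ℝ} (hs : 1 ≤ s) {z : ℂ} (hz : ‖z - airyDir * s‖ ≤ 1) :
    ‖AiDeriv z‖ ≤ Real.exp (7 - s) := by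
  have hd : Differentiable ℂ Ai := fun z => (hasDerivAt_Ai z).differentiableAt
  have h := Complex.norm_deriv_le_of_forall_mem_sphere_norm_le (f := Ai) (c := z) one_pos
    hd.diffContOnCl (C := Real.exp (7 - s)) (fun w hw => norm_Ai_le_near_ray hs ?_)
  · rwa [(hasDerivAt_Ai z).deriv, div_one] at h
  · rw [mem_sphere_iff_norm] at hw
    calc ‖w - airyDir * s‖ = ‖(w - z) + (z - airyDir * s)‖ := by ring_nf
      _ ≤ 2 := (norm_add_le _ _).trans (by linarith)

/-- The Airy function does not vanish identically, even on the real axis. -/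
theorem exists_Ai_ne_zero : ∃ x : ℝ, Ai x ≠ 0 := by
  by_contra! h
  -- Up to nonzero factors, $\mathrm{Ai}(-2\pi x)$ is the Fourier transform at $x$ of the nowhere
  -- vanishing function `airyLine 0 1`; inversion then gives a contradiction.
  have hF : FourierTransform.fourier (airyLine 0 1) = 0 := by
    funext x
    have h1 := h (-2 * Real.pi * x)
    rw [Ai_eq_integral_airyLine _ one_pos, mul_eq_zero] at h1
    have h2 := h1.resolve_left (by simp [Real.pi_ne_zero])
    have e : airyLine ((-2 * Real.pi * x : ℝ) : ℂ) 1 = fun t : ℝ =>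
        exp (((2 * Real.pi * x : ℝ) : ℂ)) *
          (exp (((-2 * Real.pi * inner ℝ t x : ℝ) : ℂ) * I) • airyLine 0 1 t) := by
      funext t
      simp only [airyLine, smul_eq_mul]
      rw [← Complex.exp_add, ← Complex.exp_add]
      congr 1
      simp only [RCLike.inner_apply, conj_trivial]
      push_cast
      linear_combination (-2 * (Real.pi : ℂ) * x) * I_sq
    rw [e, integral_const_mul, mul_eq_zero] at h2
    rw [Real.fourier_eq']
    exact h2.resolve_left (Complex.exp_ne_zero _)
  have hinv := (continuous_airyLine 0 1).fourierInv_fourier_eq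
    (by simpa using integrable_moment 0 0 one_pos)
    (by rw [hF]; exact integrable_zero _ _ _)
  have h0 := congrFun hinv 0
  rw [hF, Real.fourierInv_eq'] at h0
  simp only [Pi.zero_apply, smul_zero, integral_zero] at h0
  exact Complex.exp_ne_zero _ h0.symm

/-- The derivative of `airyG lam`. -/
def airyGDeriv (lam : ℂ) (s : ℝ) : ℂ := airyDir * AiDeriv (airyDir * ((s : ℂ) + I * lam))

theorem hasDerivAt_airyG (lam : ℂ) (s : ℝ) :
    HasDerivAt (airyG lam) (airyGDeriv lam s) s := by
  have h1 : HasDerivAt (fun s : ℝ => airyDir * ((s : ℂ) + I * lam)) (airyDir * 1) s :=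
    ((hasDerivAt_id s).ofReal_comp.add_const _).const_mul _
  refine ((hasDerivAt_Ai _).comp s h1).congr_deriv ?_
  rw [airyGDeriv]; ring

theorem hasDerivAt_airyGDeriv (lam : ℂ) (s : ℝ) :
    HasDerivAt (airyGDeriv lam) ((I * s - lam) * airyG lam s) s := by
  have h1 : HasDerivAt (fun s : ℝ => airyDir * ((s : ℂ) + I * lam)) (airyDir * 1) s :=
    ((hasDerivAt_id s).ofReal_comp.add_const _).const_mul _
  refine (((hasDerivAt_AiDeriv _).comp s h1).const_mul airyDir).congr_deriv ?_
  have e : airyG lam s = Ai (airyDir * ((s : ℂ) + I * lam)) := rfl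
  rw [e]
  linear_combination (((s : ℂ) + I * lam) * Ai (airyDir * ((s : ℂ) + I * lam))) *
    airyDir_pow_three + lam * Ai (airyDir * ((s : ℂ) + I * lam)) * I_sq

theorem norm_airyG_arg_le {lam : ℂ} (hlam : ‖lam‖ ≤ 1) (s : ℝ) :
    ‖airyDir * ((s : ℂ) + I * lam) - airyDir * s‖ ≤ 1 := by
  have e : airyDir * ((s : ℂ) + I * lam) - airyDir * s = airyDir * (I * lam) := by ring
  rw [e, norm_mul, norm_mul, norm_airyDir, norm_I]
  linarith

theorem norm_airyG_le {lam : ℂ} (hlam : ‖lam‖ ≤ 1) {s : ℝ} (hs : 1 ≤ s) :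
    ‖airyG lam s‖ ≤ Real.exp (7 - s) :=
  norm_Ai_le_near_ray hs ((norm_airyG_arg_le hlam s).trans one_le_two)

theorem norm_airyGDeriv_le {lam : ℂ} (hlam : ‖lam‖ ≤ 1) {s : ℝ} (hs : 1 ≤ s) :
    ‖airyGDeriv lam s‖ ≤ Real.exp (7 - s) := by
  rw [airyGDeriv, norm_mul, norm_airyDir, one_mul]
  exact norm_AiDeriv_le_near_ray hs (norm_airyG_arg_le hlam s)

/-- Identity theorem: zeros filling a half-line would make the entire function $\mathrm{Ai}$ vanish
identically. -/
theorem exists_airyG_ne_zero (lam : ℂ) (a : ℝ) : ∃ s : ℝ, a < s ∧ airyG lam s ≠ 0 := by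
  by_contra! h
  set φ : ℂ → ℂ := fun w => Ai (airyDir * (w + I * lam)) with hφ
  have hAi : Differentiable ℂ Ai := fun z => (hasDerivAt_Ai z).differentiableAt
  have hd : Differentiable ℂ φ := hAi.comp (by fun_prop)
  have hz : φ = fun _ => 0 := by
    refine AnalyticOnNhd.eq_of_frequently_eq (fun w _ => hd.analyticAt w) (z₀ := ((a + 1 : ℝ) : ℂ))
      (fun _ _ => analyticAt_const) ?_
    have ht : Filter.Tendsto (fun s : ℝ => (s : ℂ)) (nhdsWithin (a + 1) {a + 1}ᶜ)
        (nhdsWithin ((a + 1 : ℝ) : ℂ) {((a + 1 : ℝ) : ℂ)}ᶜ) := by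
      refine tendsto_nhdsWithin_of_tendsto_nhds_of_eventually_within _ ?_ ?_
      · exact (Complex.continuous_ofReal.tendsto _).mono_left nhdsWithin_le_nhds
      · filter_upwards [self_mem_nhdsWithin] with s hs
        exact fun h => hs (Complex.ofReal_injective h)
    refine ht.frequently (Filter.Eventually.frequently ?_)
    filter_upwards [mem_nhdsWithin_of_mem_nhds (Ioi_mem_nhds (lt_add_one a))] with s hs
    exact h s hs
  obtain ⟨x, hx⟩ := exists_Ai_ne_zero
  have hne : airyDir ≠ 0 := by
    intro h0
    have := norm_airyDir
    simp [h0] at this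
  apply hx
  have := congrFun hz (x / airyDir - I * lam)
  simp only [hφ, sub_add_cancel] at this
  rwa [mul_div_cancel₀ _ hne] at this


/-! ### Everywhere convergent power series and the Frobenius solutions -/

/-- The coefficients of the termwise derivative of `∑ cₙ sⁿ`. -/
def derivCoeff (c : ℕ → ℂ) (n : ℕ) : ℂ := ((n : ℂ) + 1) * c (n + 1)

/-- Since $n\le2^n$, the differentiated series is dominated by the original one at the larger radius
$2(r+1)$. -/
theorem norm_term_deriv_le (c : ℕ → ℂ) {r : ℝ} (n : ℕ) {y : ℂ} (hy : ‖y‖ ≤ r) :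
    ‖c n * (n * y ^ (n - 1))‖ ≤ ‖c n * ((2 * (r + 1) : ℝ) : ℂ) ^ n‖ := by
  have hr : 0 ≤ r := (norm_nonneg y).trans hy
  rw [norm_mul, norm_mul, norm_mul, norm_pow, norm_pow, Complex.norm_real, Complex.norm_natCast,
    Real.norm_of_nonneg (by positivity), mul_pow]
  have h1 : (n : ℝ) ≤ 2 ^ n := by exact_mod_cast n.lt_two_pow_self.le
  have h2 : ‖y‖ ^ (n - 1) ≤ (r + 1) ^ n :=
    (pow_le_pow_left₀ (norm_nonneg y) (by linarith) _).trans
      (pow_le_pow_right₀ (by linarith) (Nat.sub_le n 1))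
  gcongr

theorem tsum_term_deriv (c : ℕ → ℂ) (s : ℂ) (hs : Summable fun n => c n * (n * s ^ (n - 1))) :
    ∑' n, c n * (n * s ^ (n - 1)) = ∑' n, derivCoeff c n * s ^ n := by
  rw [hs.tsum_eq_zero_add]
  simp only [Nat.cast_zero, zero_mul, mul_zero, zero_add, Nat.add_sub_cancel, derivCoeff]
  congr 1
  funext n
  push_cast
  ring

theorem summable_derivCoeff {c : ℕ → ℂ} (hc : ∀ s : ℂ, Summable fun n => c n * s ^ n) (s : ℂ) :
    Summable fun n => derivCoeff c n * s ^ n := by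
  have h : Summable fun n => c n * (n * s ^ (n - 1)) :=
    Summable.of_norm_bounded (hc _).norm fun n => norm_term_deriv_le c n le_rfl
  refine ((summable_nat_add_iff 1).2 h).congr fun n => ?_
  simp only [Nat.add_sub_cancel, derivCoeff]
  push_cast
  ring

theorem hasDerivAt_tsum_pow {c : ℕ → ℂ} (hc : ∀ s : ℂ, Summable fun n => c n * s ^ n) (s : ℂ) :
    HasDerivAt (fun s => ∑' n, c n * s ^ n) (∑' n, derivCoeff c n * s ^ n) s := by
  have hb : ∀ n, ∀ y ∈ Metric.ball (0 : ℂ) (‖s‖ + 1), ‖c n * (n * y ^ (n - 1))‖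
      ≤ ‖c n * ((2 * (‖s‖ + 1 + 1) : ℝ) : ℂ) ^ n‖ := fun n y hy =>
    norm_term_deriv_le c n (mem_ball_zero_iff.1 hy).le
  have hs : s ∈ Metric.ball (0 : ℂ) (‖s‖ + 1) := by simp
  rw [← tsum_term_deriv c s (Summable.of_norm_bounded (hc _).norm fun n => hb n s hs)]
  exact hasDerivAt_tsum_of_isPreconnected (hc ((2 * (‖s‖ + 1 + 1) : ℝ) : ℂ)).norm Metric.isOpen_ball
    (convex_ball _ _).isPreconnected (fun n y _ => (hasDerivAt_pow n y).const_mul (c n)) hb hs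
    (hc s) hs

/-- The first derivative of the Frobenius series. -/
def frobeniusSeries₁ (δ : ℝ) (lam s : ℂ) : ℂ :=
  ∑' n, derivCoeff (frobeniusCoeff δ lam) n * s ^ n

/-- The second derivative of the Frobenius series. -/
def frobeniusSeries₂ (δ : ℝ) (lam s : ℂ) : ℂ :=
  ∑' n, derivCoeff (derivCoeff (frobeniusCoeff δ lam)) n * s ^ n

theorem hasDerivAt_frobeniusSeries (δ : ℝ) (lam s : ℂ) :
    HasDerivAt (frobeniusSeries δ lam) (frobeniusSeries₁ δ lam s) s :=
  hasDerivAt_tsum_pow (frobeniusCoeff_summable δ lam) s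

theorem hasDerivAt_frobeniusSeries₁ (δ : ℝ) (lam s : ℂ) :
    HasDerivAt (frobeniusSeries₁ δ lam) (frobeniusSeries₂ δ lam s) s :=
  hasDerivAt_tsum_pow (summable_derivCoeff (frobeniusCoeff_summable δ lam)) s

theorem frobeniusSeries_zero (δ : ℝ) (lam : ℂ) : frobeniusSeries δ lam 0 = 1 := by
  rw [frobeniusSeries, tsum_eq_single 0 (fun n hn => by simp [hn])]
  simp [frobeniusCoeff]

/-- The equation left after the factor $s^\delta$ is removed; comparing coefficients gives the
defining recurrence. -/
theorem frobeniusSeries_equation {δ : ℝ} (hδ : ∀ n : ℕ, (n : ℝ) + 1 + 2 * δ ≠ 0) (lam s : ℂ) :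
    s * frobeniusSeries₂ δ lam s + 2 * δ * frobeniusSeries₁ δ lam s
      = (I * s ^ 2 - lam * s) * frobeniusSeries δ lam s := by
  have hδ' : ∀ n : ℕ, (n : ℂ) + 1 + 2 * δ ≠ 0 := fun n => by exact_mod_cast hδ n
  set c := frobeniusCoeff δ lam with hc
  have h0 := frobeniusCoeff_summable δ lam s
  have h1 := summable_derivCoeff (frobeniusCoeff_summable δ lam) s
  have h2 := summable_derivCoeff (summable_derivCoeff (frobeniusCoeff_summable δ lam)) s
  have h1' := (summable_nat_add_iff 1).2 h1
  have h0' := (summable_nat_add_iff 1).2 h0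
  have hc2 : 2 * (1 + 2 * (δ : ℂ)) * c 2 = -lam * c 0 := by
    have := hδ' 0
    simp only [Nat.cast_zero, zero_add] at this
    simp only [hc, frobeniusCoeff]
    field_simp
  have hc3 : ∀ n : ℕ, ((n : ℂ) + 3) * ((n : ℂ) + 2 + 2 * δ) * c (n + 3)
      = -lam * c (n + 1) + I * c n := fun n => by
    have h3 : (n : ℂ) + 3 ≠ 0 := by exact_mod_cast Nat.succ_ne_zero (n + 2)
    have h4 := hδ' (n + 1)
    have h5 : (n : ℂ) + 2 + 2 * δ ≠ 0 := by
      intro h; apply h4; push_cast; rw [← h]; ring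
    simp only [hc, frobeniusCoeff]
    field_simp
  -- The constant term of the derivative is $g_1=0$, which lets both sums start at the same power of
  -- $s$.
  have e1 : frobeniusSeries₁ δ lam s = ∑' n, derivCoeff c (n + 1) * s ^ (n + 1) := by
    rw [frobeniusSeries₁, h1.tsum_eq_zero_add]
    simp [derivCoeff, frobeniusCoeff, hc]
  have e2 : s * frobeniusSeries₂ δ lam s + 2 * δ * frobeniusSeries₁ δ lam s
      = ∑' n : ℕ, ((n : ℂ) + 2) * ((n : ℂ) + 1 + 2 * δ) * c (n + 2) * s ^ (n + 1) := by
    rw [e1, frobeniusSeries₂, ← tsum_mul_left, ← tsum_mul_left,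
      ← (h2.mul_left s).tsum_add (h1'.mul_left _)]
    congr 1
    funext n
    simp only [derivCoeff, ← hc]
    push_cast
    ring
  have e3 : (∑' n : ℕ, ((n : ℂ) + 2) * ((n : ℂ) + 1 + 2 * δ) * c (n + 2) * s ^ (n + 1))
      = -lam * c 0 * s + ∑' n, (-lam * s * (c (n + 1) * s ^ (n + 1))
        + I * s ^ 2 * (c n * s ^ n)) := by
    rw [Summable.tsum_eq_zero_add]
    · congr 1
      · rw [← hc2]; push_cast; ring
      · congr 1
        funext n
        have := hc3 n
        push_cast
        linear_combination s ^ (n + 2) * this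
    · refine ((h2.mul_left s).add (h1'.mul_left (2 * (δ : ℂ)))).congr fun n => ?_
      simp only [derivCoeff, ← hc]
      push_cast
      ring
  rw [e2, e3, (h0'.mul_left _).tsum_add (h0.mul_left _), tsum_mul_left, tsum_mul_left,
    frobeniusSeries, h0.tsum_eq_zero_add]
  simp only [pow_zero, mul_one]
  ring

/-- `f` solves `f'' = V f` on `S`, with derivative `g`. -/
def SolvesOn (V : ℝ → ℂ) (S : Set ℝ) (f g : ℝ → ℂ) : Prop :=
  ∀ s ∈ S, HasDerivAt f (g s) s ∧ HasDerivAt g (V s * f s) s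

/-- The potential `γ (γ + 1) / s² + i s - lam`. -/
def modelPotential (γ : ℝ) (lam : ℂ) (s : ℝ) : ℂ :=
  ((γ * (γ + 1) / s ^ 2 : ℝ) : ℂ) + (I * s - lam)

/-- The solution `s^δ ∑ gₙ sⁿ`. -/
def frobeniusSol (δ : ℝ) (lam : ℂ) (s : ℝ) : ℂ := ((s ^ δ : ℝ) : ℂ) * frobeniusSeries δ lam s

/-- The derivative of `frobeniusSol`. -/
def frobeniusSolDeriv (δ : ℝ) (lam : ℂ) (s : ℝ) : ℂ :=
  ((s ^ (δ - 1) : ℝ) : ℂ) * (δ * frobeniusSeries δ lam s + s * frobeniusSeries₁ δ lam s)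

/-- The second hypothesis is the indicial equation, which cancels the $s^{\delta-2}$ term against
$\gamma(\gamma+1)/s^2$. -/
theorem frobeniusSol_solvesOn {γ δ : ℝ} (hδ : ∀ n : ℕ, (n : ℝ) + 1 + 2 * δ ≠ 0)
    (hγδ : δ * (δ - 1) = γ * (γ + 1)) (lam : ℂ) :
    SolvesOn (modelPotential γ lam) (Ioi 0) (frobeniusSol δ lam) (frobeniusSolDeriv δ lam) := by
  intro s hs
  have hs0 : s ≠ 0 := (mem_Ioi.1 hs).ne'
  have hsC : (s : ℂ) ≠ 0 := by exact_mod_cast hs0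
  have hF := (hasDerivAt_frobeniusSeries δ lam s).comp_ofReal
  have hF1 := (hasDerivAt_frobeniusSeries₁ δ lam s).comp_ofReal
  have hid : HasDerivAt (fun s : ℝ => (s : ℂ)) 1 s := by
    simpa using (hasDerivAt_id s).ofReal_comp
  have hp : ∀ δ : ℝ, HasDerivAt (fun s : ℝ => ((s ^ δ : ℝ) : ℂ)) ((δ * s ^ (δ - 1) : ℝ) : ℂ) s :=
    fun δ => (Real.hasDerivAt_rpow_const (Or.inl hs0)).ofReal_comp
  have e1 : s ^ δ = s ^ (δ - 1) * s := by
    rw [Real.rpow_sub_one hs0, div_mul_cancel₀ _ hs0]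
  have e2 : s ^ (δ - 1) = s ^ (δ - 1 - 1) * s := by
    rw [Real.rpow_sub_one hs0 (δ - 1), div_mul_cancel₀ _ hs0]
  constructor
  · refine ((hp δ).mul hF).congr_deriv ?_
    rw [frobeniusSolDeriv, e1]
    push_cast
    ring
  · refine ((hp (δ - 1)).mul ((hF.const_mul (δ : ℂ)).add (hid.mul hF1))).congr_deriv ?_
    have heq := frobeniusSeries_equation hδ lam s
    have hγδ' : (δ : ℂ) * (δ - 1) = γ * (γ + 1) := by exact_mod_cast hγδ
    simp only [frobeniusSol, modelPotential, Pi.add_apply, Pi.mul_apply]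
    rw [e1, e2]
    push_cast
    field_simp
    linear_combination ((s ^ (δ - 1 - 1) : ℝ) : ℂ) * s * heq +
      ((s ^ (δ - 1 - 1) : ℝ) : ℂ) * frobeniusSeries δ lam s * hγδ'

theorem tendsto_frobeniusSol_zero {δ : ℝ} (hδ : 1 < δ) (lam : ℂ) :
    Filter.Tendsto (frobeniusSol δ lam) (nhdsWithin 0 (Ioi 0)) (nhds 0) ∧
    Filter.Tendsto (frobeniusSolDeriv δ lam) (nhdsWithin 0 (Ioi 0)) (nhds 0) := by
  have hF : Continuous (frobeniusSeries δ lam) := continuous_iff_continuousAt.2 fun s =>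
    (hasDerivAt_frobeniusSeries δ lam s).continuousAt
  have hF1 : Continuous (frobeniusSeries₁ δ lam) := continuous_iff_continuousAt.2 fun s =>
    (hasDerivAt_frobeniusSeries₁ δ lam s).continuousAt
  have hp : ∀ δ : ℝ, 0 < δ → Continuous fun s : ℝ => ((s ^ δ : ℝ) : ℂ) := fun δ h =>
    Complex.continuous_ofReal.comp (Real.continuous_rpow_const h.le)
  have h1 : Continuous (frobeniusSol δ lam) := by
    have := hp δ (by linarith)
    unfold frobeniusSol
    fun_prop
  have h2 : Continuous (frobeniusSolDeriv δ lam) := by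
    have := hp (δ - 1) (by linarith)
    unfold frobeniusSolDeriv
    fun_prop
  refine ⟨?_, ?_⟩
  · have := (h1.tendsto 0).mono_left (nhdsWithin_le_nhds (s := Ioi 0))
    simpa [frobeniusSol, Real.zero_rpow (show δ ≠ 0 by linarith)] using this
  · have := (h2.tendsto 0).mono_left (nhdsWithin_le_nhds (s := Ioi 0))
    simpa [frobeniusSolDeriv, Real.zero_rpow (show δ - 1 ≠ 0 by linarith)] using this

/-- Wronskians are constant. -/
theorem SolvesOn.wronskian_eq {V f₁ g₁ f₂ g₂ : ℝ → ℂ} {a : ℝ} (h₁ : SolvesOn V (Ioi a) f₁ g₁)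
    (h₂ : SolvesOn V (Ioi a) f₂ g₂) {s t : ℝ} (hs : a < s) (ht : a < t) :
    f₁ s * g₂ s - g₁ s * f₂ s = f₁ t * g₂ t - g₁ t * f₂ t := by
  have hd : ∀ x ∈ Ioi a, HasDerivAt (fun x => f₁ x * g₂ x - g₁ x * f₂ x) 0 x := fun x hx => by
    refine (((h₁ x hx).1.mul (h₂ x hx).2).sub ((h₁ x hx).2.mul (h₂ x hx).1)).congr_deriv ?_
    ring
  exact isOpen_Ioi.is_const_of_deriv_eq_zero isPreconnected_Ioi
    (f := fun x => f₁ x * g₂ x - g₁ x * f₂ x)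
    (fun x hx => (hd x hx).differentiableAt.differentiableWithinAt)
    (fun x hx => (hd x hx).deriv) hs ht

theorem frobenius_exponent_ne {γ : ℝ} (hγ : 1 / 2 < γ) (hres : ∀ k : ℕ, γ ≠ ((k : ℝ) + 1) / 2) :
    (∀ n : ℕ, (n : ℝ) + 1 + 2 * (-γ) ≠ 0) ∧ (∀ n : ℕ, (n : ℝ) + 1 + 2 * (γ + 1) ≠ 0) := by
  refine ⟨fun n h => hres n (by linarith), fun n h => ?_⟩
  have : (0 : ℝ) ≤ n := n.cast_nonneg
  linarith

/-- The exponents of the two solutions sum to $1$, so all powers of $s$ cancel up to a continuous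
expression. The constant Wronskian is read off from its value at $s=0$. -/
theorem wronskian_frobenius {γ : ℝ} (hγ : 1 / 2 < γ) (hres : ∀ k : ℕ, γ ≠ ((k : ℝ) + 1) / 2)
    (lam : ℂ) {s : ℝ} (hs : 0 < s) :
    frobeniusSol (-γ) lam s * frobeniusSolDeriv (γ + 1) lam s
      - frobeniusSolDeriv (-γ) lam s * frobeniusSol (γ + 1) lam s = 2 * γ + 1 := by
  obtain ⟨hp, hm⟩ := frobenius_exponent_ne hγ hres
  have h₁ := frobeniusSol_solvesOn (γ := γ) hp (by ring) lam
  have h₂ := frobeniusSol_solvesOn (γ := γ) hm (by ring) lam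
  set φ : ℝ → ℂ := fun s => (2 * γ + 1) * frobeniusSeries (-γ) lam s * frobeniusSeries (γ + 1) lam s
    + s * (frobeniusSeries (-γ) lam s * frobeniusSeries₁ (γ + 1) lam s
      - frobeniusSeries₁ (-γ) lam s * frobeniusSeries (γ + 1) lam s) with hφ
  have hW : ∀ t : ℝ, 0 < t → frobeniusSol (-γ) lam t * frobeniusSolDeriv (γ + 1) lam t
      - frobeniusSolDeriv (-γ) lam t * frobeniusSol (γ + 1) lam t = φ t := fun t ht => by
    simp only [frobeniusSol, frobeniusSolDeriv, hφ]
    have e1 : ((t ^ (-γ) : ℝ) : ℂ) * ((t ^ (γ + 1 - 1) : ℝ) : ℂ) = 1 := by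
      rw [← Complex.ofReal_mul, ← Real.rpow_add ht]; simp
    have e2 : ((t ^ (-γ - 1) : ℝ) : ℂ) * ((t ^ (γ + 1) : ℝ) : ℂ) = 1 := by
      rw [← Complex.ofReal_mul, ← Real.rpow_add ht]; simp
    push_cast at *
    linear_combination
      (frobeniusSeries (-γ) lam t * ((γ + 1) * frobeniusSeries (γ + 1) lam t
        + t * frobeniusSeries₁ (γ + 1) lam t)) * e1
      - ((-γ * frobeniusSeries (-γ) lam t + t * frobeniusSeries₁ (-γ) lam t)
        * frobeniusSeries (γ + 1) lam t) * e2
  have hF : ∀ δ, Continuous (frobeniusSeries δ lam) := fun δ => continuous_iff_continuousAt.2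
    fun s => (hasDerivAt_frobeniusSeries δ lam s).continuousAt
  have hF1 : ∀ δ, Continuous (frobeniusSeries₁ δ lam) := fun δ => continuous_iff_continuousAt.2
    fun s => (hasDerivAt_frobeniusSeries₁ δ lam s).continuousAt
  have hφc : Continuous φ := by
    have := hF (-γ); have := hF (γ + 1); have := hF1 (-γ); have := hF1 (γ + 1)
    fun_prop
  have ht : Filter.Tendsto φ (nhdsWithin 0 (Ioi 0)) (nhds (2 * γ + 1)) := by
    have := (hφc.tendsto 0).mono_left (nhdsWithin_le_nhds (s := Ioi 0))
    simpa [hφ, frobeniusSeries_zero] using this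
  rw [hW s hs]
  refine tendsto_nhds_unique (tendsto_const_nhds.congr' ?_) ht
  filter_upwards [self_mem_nhdsWithin] with t ht
  rw [← hW s hs, ← hW t ht, h₁.wronskian_eq h₂ hs ht]


/-! ### Energy functionals -/

theorem hasDerivAt_re_im {f : ℝ → ℂ} {f' : ℂ} {s : ℝ} (h : HasDerivAt f f' s) :
    HasDerivAt (fun s => (f s).re) f'.re s ∧ HasDerivAt (fun s => (f s).im) f'.im s :=
  ⟨Complex.reCLM.hasFDerivAt.comp_hasDerivAt s h, Complex.imCLM.hasFDerivAt.comp_hasDerivAt s h⟩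

/-- The quantity `Re ((1 - i) (conj z) w)`. -/
def tiltedPairing (z w : ℂ) : ℝ := z.re * w.re + z.im * w.im + (z.re * w.im - z.im * w.re)

theorem abs_tiltedPairing_le (z w : ℂ) : |tiltedPairing z w| ≤ 4 * (‖z‖ * ‖w‖) := by
  have h1 := abs_re_le_norm z
  have h2 := abs_im_le_norm z
  have h3 := abs_re_le_norm w
  have h4 := abs_im_le_norm w
  have e1 : |z.re * w.re| ≤ ‖z‖ * ‖w‖ := by rw [abs_mul]; gcongr
  have e2 : |z.im * w.im| ≤ ‖z‖ * ‖w‖ := by rw [abs_mul]; gcongr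
  have e3 : |z.re * w.im| ≤ ‖z‖ * ‖w‖ := by rw [abs_mul]; gcongr
  have e4 : |z.im * w.re| ≤ ‖z‖ * ‖w‖ := by rw [abs_mul]; gcongr
  rw [abs_le] at *
  unfold tiltedPairing
  constructor <;> linarith [e1.1, e1.2, e2.1, e2.2, e3.1, e3.2, e4.1, e4.2]

/-- The real part of $\bar f f'$ alone would see only $\operatorname{Re}V$ and miss the term $is$.
The factor $1-i$ brings in $\operatorname{Im}V$ and keeps coefficient $1$ on $|f'|^2$. -/
theorem hasDerivAt_tiltedPairing {V : ℂ} {f g : ℝ → ℂ} {s : ℝ} (hf : HasDerivAt f (g s) s)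
    (hg : HasDerivAt g (V * f s) s) :
    HasDerivAt (fun s => tiltedPairing (f s) (g s))
      (normSq (g s) + (V.re + V.im) * normSq (f s)) s := by
  obtain ⟨hf1, hf2⟩ := hasDerivAt_re_im hf
  obtain ⟨hg1, hg2⟩ := hasDerivAt_re_im hg
  refine (((hf1.mul hg1).add (hf2.mul hg2)).add ((hf1.mul hg2).sub (hf2.mul hg1))).congr_deriv ?_
  simp only [normSq_apply, mul_re, mul_im]
  ring

theorem hasDerivAt_normSq {f : ℝ → ℂ} {f' : ℂ} {s : ℝ} (hf : HasDerivAt f f' s) :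
    HasDerivAt (fun s => normSq (f s)) (2 * ((f s).re * f'.re + (f s).im * f'.im)) s := by
  obtain ⟨hf1, hf2⟩ := hasDerivAt_re_im hf
  simp only [normSq_apply]
  refine ((hf1.mul hf1).add (hf2.mul hf2)).congr_deriv ?_
  ring

/-- The perturbation is at most $1/2$. It is beaten by $s$ when $s\ge1$ and by
$\gamma(\gamma+1)/s^2>3/4$ when $s<1$. -/
theorem model_potential_re_add_im_pos {γ : ℝ} (hγ : 1 / 2 < γ) {lam : ℂ} (hlam : ‖lam‖ ≤ 1 / 4)
    {s : ℝ} (hs : 0 < s) : 0 < (modelPotential γ lam s).re + (modelPotential γ lam s).im := by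
  have h1 := abs_le.1 ((abs_re_le_norm lam).trans hlam)
  have h2 := abs_le.1 ((abs_im_le_norm lam).trans hlam)
  have hre : (modelPotential γ lam s).re = γ * (γ + 1) / s ^ 2 - lam.re := by
    simp [modelPotential, -ofReal_div, -ofReal_mul, -ofReal_add, -ofReal_pow, ofReal_re]
    ring
  have him : (modelPotential γ lam s).im = s - lam.im := by
    simp [modelPotential, -ofReal_div, -ofReal_mul, -ofReal_add, -ofReal_pow, ofReal_re]
  rw [hre, him]
  have hg : 3 / 4 < γ * (γ + 1) := by nlinarith
  rcases le_or_gt 1 s with h | h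
  · have : 0 < γ * (γ + 1) / s ^ 2 := by positivity
    linarith [h1.2, h2.2]
  · have : γ * (γ + 1) ≤ γ * (γ + 1) / s ^ 2 := by
      rw [le_div_iff₀ (by positivity)]
      have : s ^ 2 ≤ 1 := by nlinarith
      nlinarith
    linarith [h1.2, h2.2]

theorem tendsto_tiltedPairing {f g : ℝ → ℂ} {l : Filter ℝ} (hf : Filter.Tendsto f l (nhds 0))
    (hg : Filter.Tendsto g l (nhds 0)) :
    Filter.Tendsto (fun s => tiltedPairing (f s) (g s)) l (nhds 0) := by
  refine squeeze_zero_norm (fun s => abs_tiltedPairing_le (f s) (g s)) ?_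
  simpa using (hf.norm.mul hg.norm).const_mul 4

/-- A solution of the model equation that vanishes at both ends is zero. -/
theorem model_solution_eq_zero {γ : ℝ} (hγ : 1 / 2 < γ) {lam : ℂ} (hlam : ‖lam‖ ≤ 1 / 4)
    {f g : ℝ → ℂ} (h : SolvesOn (modelPotential γ lam) (Ioi 0) f g)
    (hf0 : Filter.Tendsto f (nhdsWithin 0 (Ioi 0)) (nhds 0))
    (hg0 : Filter.Tendsto g (nhdsWithin 0 (Ioi 0)) (nhds 0))
    (hf : Filter.Tendsto f Filter.atTop (nhds 0)) (hg : Filter.Tendsto g Filter.atTop (nhds 0))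
    {s : ℝ} (hs : 0 < s) : f s = 0 := by
  have hd : ∀ x ∈ Ioi (0 : ℝ), HasDerivAt (fun s => tiltedPairing (f s) (g s))
      (normSq (g x) + ((modelPotential γ lam x).re + (modelPotential γ lam x).im)
        * normSq (f x)) x := fun x hx => hasDerivAt_tiltedPairing (h x hx).1 (h x hx).2
  have hmono : MonotoneOn (fun s => tiltedPairing (f s) (g s)) (Ioi 0) := by
    refine monotoneOn_of_deriv_nonneg (convex_Ioi 0)
      (fun x hx => (hd x hx).continuousAt.continuousWithinAt)
      (fun x hx => (hd x (interior_subset hx)).differentiableAt.differentiableWithinAt)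
      fun x hx => ?_
    rw [(hd x (interior_subset hx)).deriv]
    have := model_potential_re_add_im_pos hγ hlam (interior_subset hx)
    have := normSq_nonneg (f x)
    have := normSq_nonneg (g x)
    positivity
  -- A monotone function with limit $0$ at both ends vanishes, and then so does its derivative, a
  -- sum of nonnegative terms.
  have hE : ∀ x ∈ Ioi (0 : ℝ), tiltedPairing (f x) (g x) = 0 := fun x hx => by
    apply le_antisymm
    · refine ge_of_tendsto (tendsto_tiltedPairing hf hg) ?_
      filter_upwards [Filter.eventually_ge_atTop x] with y hy
      exact hmono hx (lt_of_lt_of_le hx hy) hy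
    · refine le_of_tendsto (tendsto_tiltedPairing hf0 hg0) ?_
      filter_upwards [Ioo_mem_nhdsGT (mem_Ioi.1 hx)] with y hy
      exact hmono hy.1 hx hy.2.le
  have h0 : HasDerivAt (fun s => tiltedPairing (f s) (g s)) 0 s :=
    (hasDerivAt_const s (0 : ℝ)).congr_of_eventuallyEq
      (Filter.eventuallyEq_of_mem (Ioi_mem_nhds hs) hE)
  have h1 := (hd s hs).unique h0
  have hV := model_potential_re_add_im_pos hγ hlam hs
  have hP := normSq_nonneg (g s)
  have hN := normSq_nonneg (f s)
  have : normSq (f s) = 0 := by nlinarith [mul_nonneg hV.le hN]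
  exact normSq_eq_zero.1 this

/-- `|w|² + s |z|² + (3 / 2) √s Re ((1 - i) (conj z) w)`. -/
def airyEnergy (s : ℝ) (z w : ℂ) : ℝ :=
  normSq w + s * normSq z + 3 / 2 * √s * tiltedPairing z w

theorem abs_le_div_twenty {r m S : ℝ} (hr : 10 ≤ r) (hS : 0 ≤ S) (h₁ : r * (2 * m) ≤ S)
    (h₂ : -S ≤ r * (2 * m)) : |m| ≤ S / 20 := by
  rw [abs_le]; constructor <;> nlinarith

/-- Young's inequality with $S=|w|^2+r^2|z|^2$: $r|z||w|\le S/2$. The tilt contributes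
$|1-i|=\sqrt2$, and $0.71>\sqrt2/2$; the bounds $S/20$ use $r\ge10$. -/
theorem pairing_bounds {r : ℝ} (hr : 10 ≤ r) (a b c d : ℝ) :
    -(0.71 * (c * c + d * d + r ^ 2 * (a * a + b * b)))
      ≤ r * (a * c + b * d + (a * d - b * c)) ∧
    |a * c + b * d| ≤ (c * c + d * d + r ^ 2 * (a * a + b * b)) / 20 ∧
    |a * d - b * c| ≤ (c * c + d * d + r ^ 2 * (a * a + b * b)) / 20 := by
  have hS : 0 ≤ c * c + d * d + r ^ 2 * (a * a + b * b) :=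
    add_nonneg (add_nonneg (mul_self_nonneg c) (mul_self_nonneg d))
      (mul_nonneg (sq_nonneg r) (add_nonneg (mul_self_nonneg a) (mul_self_nonneg b)))
  refine ⟨?_, abs_le_div_twenty hr hS ?_ ?_, abs_le_div_twenty hr hS ?_ ?_⟩
  · linarith [sq_nonneg (142 * (r * a) + 100 * (c + d)), sq_nonneg (142 * (r * b) + 100 * (d - c)),
      mul_self_nonneg c, mul_self_nonneg d]
  · linarith [sq_nonneg (r * a - c), sq_nonneg (r * b - d)]
  · linarith [sq_nonneg (r * a + c), sq_nonneg (r * b + d)]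
  · linarith [sq_nonneg (r * a - d), sq_nonneg (r * b + c)]
  · linarith [sq_nonneg (r * a + d), sq_nonneg (r * b - c)]

/-- With $S=|w|^2+s|z|^2$ and $r=\sqrt s$, the first two terms of the energy contribute
$2r^2\mathrm{Re}((1-i)\bar zw)\ge-1.42\,rS$ to leading order, and the third contributes $\frac32rS$.
Hence the coefficient must exceed $\sqrt2$. The surplus $0.08\,rS\ge0.8\,S$ absorbs the terms in
$\lambda$ and the derivative of $\sqrt s$. -/
theorem airyEnergy_deriv_bound {r : ℝ} (hr : 10 ≤ r) {lam : ℂ} (hlam : ‖lam‖ ≤ 1 / 4) (z w : ℂ) :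
    (normSq w + r ^ 2 * normSq z) / 2 ≤
      2 * (w.re * ((I * (r ^ 2 : ℝ) - lam) * z).re + w.im * ((I * (r ^ 2 : ℝ) - lam) * z).im)
      + (normSq z + r ^ 2 * (2 * (z.re * w.re + z.im * w.im)))
      + (3 / 2 * (1 / (2 * r)) * tiltedPairing z w + 3 / 2 * r * (normSq w
        + ((I * (r ^ 2 : ℝ) - lam).re + (I * (r ^ 2 : ℝ) - lam).im) * normSq z)) := by
  have h1 := (abs_re_le_norm lam).trans hlam
  have h2 := (abs_im_le_norm lam).trans hlam
  have hr0 : 0 < r := by linarith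
  have hre : (I * (r ^ 2 : ℝ) - lam).re = -lam.re := by
    simp [-ofReal_pow]
  have him : (I * (r ^ 2 : ℝ) - lam).im = r ^ 2 - lam.im := by
    simp [-ofReal_pow]
  simp only [mul_re, mul_im, hre, him]
  obtain ⟨a, b⟩ := z
  obtain ⟨c, d⟩ := w
  simp only [tiltedPairing, normSq_mk]
  generalize lam.re = l₁ at *
  generalize lam.im = l₂ at *
  set N := a * a + b * b with hN
  set P := c * c + d * d with hP
  set m₁ := a * c + b * d with hm₁
  set m₂ := a * d - b * c with hm₂
  set S := P + r ^ 2 * N with hS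
  have hN0 : 0 ≤ N := by nlinarith
  have hP0 : 0 ≤ P := by nlinarith
  have hS0 : 0 ≤ S := by positivity
  obtain ⟨hA, hB₁, hB₂⟩ : -(0.71 * S) ≤ r * (m₁ + m₂) ∧ |m₁| ≤ S / 20 ∧ |m₂| ≤ S / 20 :=
    pairing_bounds hr a b c d
  have hSN : r ^ 2 * N ≤ S := by rw [hS]; linarith
  have e : 2 * (c * (-l₁ * a - (r ^ 2 - l₂) * b) + d * (-l₁ * b + (r ^ 2 - l₂) * a))
      = 2 * (-(l₁ * m₁) + r ^ 2 * m₂ - l₂ * m₂) := by rw [hm₁, hm₂]; ring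
  have e2 : 3 / 2 * r * (P + (-l₁ + (r ^ 2 - l₂)) * N)
      = 3 / 2 * (S * r) - 3 / 2 * ((l₁ + l₂) * (r * N)) := by rw [hS]; ring
  rw [e, e2]
  clear_value m₁ m₂ S N P
  have hl₁ : |l₁ * m₁| ≤ S / 80 := by
    rw [abs_mul]
    calc |l₁| * |m₁| ≤ 1 / 4 * (S / 20) := by gcongr
      _ = S / 80 := by ring
  have hl₂ : |l₂ * m₂| ≤ S / 80 := by
    rw [abs_mul]
    calc |l₂| * |m₂| ≤ 1 / 4 * (S / 20) := by gcongr
      _ = S / 80 := by ring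
  have hrN : r * N ≤ S / 10 := by
    have : 0 ≤ r * N := by positivity
    nlinarith
  have hlN : (l₁ + l₂) * (r * N) ≤ S / 20 := by
    have h5 : l₁ + l₂ ≤ 1 / 2 := by linarith [(abs_le.1 h1).2, (abs_le.1 h2).2]
    have h6 : 0 ≤ r * N := by positivity
    calc (l₁ + l₂) * (r * N) ≤ 1 / 2 * (r * N) := by gcongr
      _ ≤ S / 20 := by linarith
  have hq : -(S / 100) ≤ 3 / 2 * (1 / (2 * r)) * (m₁ + m₂) := by
    have e : 3 / 2 * (1 / (2 * r)) * (m₁ + m₂) = 3 / 4 * (r * (m₁ + m₂)) / r ^ 2 := by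
      field_simp; ring
    rw [e, le_div_iff₀ (by positivity)]
    have : S * 10 ^ 2 ≤ S * r ^ 2 := by gcongr
    linarith
  have hAr : -(0.71 * S) * r ≤ r * (m₁ + m₂) * r := by gcongr
  have hSr : S * 10 ≤ S * r := by gcongr
  linarith [(abs_le.1 hl₁).2, (abs_le.1 hl₂).2]

theorem hasDerivAt_airyEnergy {f g : ℝ → ℂ} {V : ℂ} {s : ℝ} (hs : 0 < s)
    (hf : HasDerivAt f (g s) s) (hg : HasDerivAt g (V * f s) s) :
    HasDerivAt (fun s => airyEnergy s (f s) (g s))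
      (2 * ((g s).re * (V * f s).re + (g s).im * (V * f s).im)
      + (normSq (f s) + s * (2 * ((f s).re * (g s).re + (f s).im * (g s).im)))
      + (3 / 2 * (1 / (2 * √s)) * tiltedPairing (f s) (g s) + 3 / 2 * √s * (normSq (g s)
        + (V.re + V.im) * normSq (f s)))) s := by
  refine (((hasDerivAt_normSq hg).add ((hasDerivAt_id s).mul (hasDerivAt_normSq hf))).add
    (((Real.hasDerivAt_sqrt hs.ne').const_mul (3 / 2)).mul
      (hasDerivAt_tiltedPairing hf hg))).congr_deriv ?_
  simp

theorem sqrt_ge_ten {s : ℝ} (hs : 100 ≤ s) : 10 ≤ √s :=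
  Real.le_sqrt_of_sq_le (by norm_num; exact hs)

theorem airyEnergy_airyG_deriv {lam : ℂ} (hlam : ‖lam‖ ≤ 1 / 4) {s : ℝ} (hs : 100 ≤ s) :
    ∃ D' : ℝ, HasDerivAt (fun s => airyEnergy s (airyG lam s) (airyGDeriv lam s)) D' s ∧
      (normSq (airyGDeriv lam s) + s * normSq (airyG lam s)) / 2 ≤ D' := by
  refine ⟨_, hasDerivAt_airyEnergy (by linarith) (hasDerivAt_airyG lam s)
    (hasDerivAt_airyGDeriv lam s), ?_⟩
  have h := airyEnergy_deriv_bound (sqrt_ge_ten hs) hlam (airyG lam s) (airyGDeriv lam s)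
  rw [Real.sq_sqrt (by linarith)] at h
  exact h

theorem airyEnergy_monotoneOn {lam : ℂ} (hlam : ‖lam‖ ≤ 1 / 4) :
    MonotoneOn (fun s => airyEnergy s (airyG lam s) (airyGDeriv lam s)) (Ici 100) := by
  refine monotoneOn_of_deriv_nonneg (convex_Ici 100)
    (fun x hx => ?_) (fun x hx => ?_) fun x hx => ?_
  · obtain ⟨D, hD, -⟩ := airyEnergy_airyG_deriv hlam hx
    exact hD.continuousAt.continuousWithinAt
  · obtain ⟨D, hD, -⟩ := airyEnergy_airyG_deriv hlam (interior_subset hx)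
    exact hD.differentiableAt.differentiableWithinAt
  · obtain ⟨D, hD, hpos⟩ := airyEnergy_airyG_deriv hlam (interior_subset hx)
    rw [hD.deriv]
    refine le_trans ?_ hpos
    have : (0 : ℝ) ≤ x := by linarith [mem_Ici.1 (interior_subset hx)]
    have := normSq_nonneg (airyG lam x)
    have := normSq_nonneg (airyGDeriv lam x)
    positivity

theorem tendsto_airyEnergy {lam : ℂ} (hlam : ‖lam‖ ≤ 1 / 4) :
    Filter.Tendsto (fun s => airyEnergy s (airyG lam s) (airyGDeriv lam s)) Filter.atTop
      (nhds 0) := by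
  have hlim := (Real.tendsto_pow_mul_exp_neg_atTop_nhds_zero 1).const_mul (8 * Real.exp 14)
  rw [mul_zero] at hlim
  refine squeeze_zero_norm' ?_ hlim
  filter_upwards [Filter.eventually_ge_atTop 1] with s hs
  have hG := norm_airyG_le (hlam.trans (by norm_num)) hs
  have hG' := norm_airyGDeriv_le (hlam.trans (by norm_num)) hs
  have hq : Real.exp (7 - s) ^ 2 ≤ Real.exp 14 * Real.exp (-s) := by
    rw [← Real.exp_nat_mul, ← Real.exp_add, Real.exp_le_exp]
    push_cast; linarith
  set e := Real.exp (7 - s)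
  have h1 : normSq (airyG lam s) ≤ e ^ 2 := by
    rw [normSq_eq_norm_sq]; gcongr
  have h2 : normSq (airyGDeriv lam s) ≤ e ^ 2 := by
    rw [normSq_eq_norm_sq]; gcongr
  have h3 : |tiltedPairing (airyG lam s) (airyGDeriv lam s)| ≤ 4 * e ^ 2 := by
    refine (abs_tiltedPairing_le _ _).trans ?_
    rw [sq]; gcongr
  have hsq : √s ≤ s := by rw [Real.sqrt_le_left (by linarith)]; nlinarith
  have h4 : ‖airyEnergy s (airyG lam s) (airyGDeriv lam s)‖ ≤ e ^ 2 + s * e ^ 2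
      + 3 / 2 * s * (4 * e ^ 2) := by
    refine (norm_add_le _ _).trans (add_le_add ((norm_add_le _ _).trans (add_le_add ?_ ?_)) ?_)
    · rwa [Real.norm_of_nonneg (normSq_nonneg _)]
    · rw [Real.norm_of_nonneg (mul_nonneg (by linarith) (normSq_nonneg _))]; gcongr
    · rw [norm_mul, Real.norm_of_nonneg (by positivity)]; gcongr; exact h3
  calc _ ≤ e ^ 2 + s * e ^ 2 + 3 / 2 * s * (4 * e ^ 2) := h4
    _ ≤ 8 * s * e ^ 2 := by nlinarith [sq_nonneg e]
    _ ≤ 8 * s * (Real.exp 14 * Real.exp (-s)) := by gcongr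
    _ = _ := by ring

theorem airyEnergy_nonpos {lam : ℂ} (hlam : ‖lam‖ ≤ 1 / 4) {s : ℝ} (hs : 100 ≤ s) :
    airyEnergy s (airyG lam s) (airyGDeriv lam s) ≤ 0 := by
  refine ge_of_tendsto (tendsto_airyEnergy hlam) ?_
  filter_upwards [Filter.eventually_ge_atTop s] with y hy
  exact airyEnergy_monotoneOn hlam hs (hs.trans hy) hy

/-- At a zero the energy equals $|G'|^2\ge0$. Being nonpositive and nondecreasing, it would vanish
from there on, and its derivative bound would force $G=0$ on a half-line. -/
theorem airyG_ne_zero {lam : ℂ} (hlam : ‖lam‖ ≤ 1 / 4) {s : ℝ} (hs : 100 ≤ s) :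
    airyG lam s ≠ 0 := by
  intro h0
  have hE : ∀ t, s ≤ t → airyEnergy t (airyG lam t) (airyGDeriv lam t) = 0 := fun t ht => by
    refine le_antisymm (airyEnergy_nonpos hlam (hs.trans ht)) ?_
    refine le_trans ?_ (airyEnergy_monotoneOn hlam hs (hs.trans ht) ht)
    simp only [h0, airyEnergy, tiltedPairing]
    simpa using normSq_nonneg _
  obtain ⟨t, ht, hne⟩ := exists_airyG_ne_zero lam s
  obtain ⟨D, hD, hpos⟩ := airyEnergy_airyG_deriv hlam (hs.trans ht.le)
  have h1 : HasDerivAt (fun s => airyEnergy s (airyG lam s) (airyGDeriv lam s)) 0 t :=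
    (hasDerivAt_const t (0 : ℝ)).congr_of_eventuallyEq
      (Filter.eventuallyEq_of_mem (Ioi_mem_nhds ht) fun x hx => hE x (le_of_lt hx))
  rw [hD.unique h1] at hpos
  have hN := normSq_pos.2 hne
  have hP := normSq_nonneg (airyGDeriv lam t)
  have : 0 < t * normSq (airyG lam t) := mul_pos (by linarith) hN
  linarith

/-- Multiplied by $|z|^2$, the energy inequality confines $\bar zw$ to a disc centred at
$-\frac34\sqrt s|z|^2(1+i)$ of radius at most $\frac38\sqrt s|z|^2$. The disc avoids the imaginary
axis because the energy coefficient $\frac32$ is less than $2$. -/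
theorem re_pairing_le_of_airyEnergy_nonpos {s : ℝ} (hs : 100 ≤ s) {z w : ℂ}
    (h : airyEnergy s z w ≤ 0) : 2 * (z.re * w.re + z.im * w.im) ≤ -normSq z := by
  have hr := sqrt_ge_ten hs
  have hrs : √s ^ 2 = s := Real.sq_sqrt (by linarith)
  rw [airyEnergy] at h
  generalize √s = r at *
  subst hrs
  obtain ⟨a, b⟩ := z
  obtain ⟨c, d⟩ := w
  simp only [tiltedPairing, normSq_mk] at h ⊢
  set N := a * a + b * b with hN
  set m₁ := a * c + b * d with hm₁
  set m₂ := a * d - b * c with hm₂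
  have hN0 : 0 ≤ N := by nlinarith
  have hNP : N * (c * c + d * d) = m₁ ^ 2 + m₂ ^ 2 := by rw [hN, hm₁, hm₂]; ring
  have h1 : m₁ ^ 2 + m₂ ^ 2 + r ^ 2 * N ^ 2 + 3 / 2 * r * N * (m₁ + m₂) ≤ 0 := by
    rw [← hNP]
    have := mul_nonpos_of_nonneg_of_nonpos hN0 h
    linarith
  have h2 : (m₁ + 3 / 4 * (r * N)) ^ 2 ≤ (3 / 8 * (r * N)) ^ 2 := by
    nlinarith [sq_nonneg (m₂ + 3 / 4 * (r * N)), sq_nonneg (r * N)]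
  have h3 := abs_le_of_sq_le_sq h2 (by positivity)
  have h4 : 10 * N ≤ r * N := by gcongr
  linarith [(abs_le.1 h3).2]

theorem norm_airyG_sq_le {lam : ℂ} (hlam : ‖lam‖ ≤ 1 / 4) {u z : ℝ} (hu : 100 ≤ u)
    (huz : u ≤ z) : ‖airyG lam z‖ ^ 2 ≤ ‖airyG lam u‖ ^ 2 * Real.exp (-(z - u)) := by
  have hd : ∀ x, HasDerivAt (fun s => normSq (airyG lam s) * Real.exp s)
      ((2 * ((airyG lam x).re * (airyGDeriv lam x).re
        + (airyG lam x).im * (airyGDeriv lam x).im)) * Real.exp x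
        + normSq (airyG lam x) * Real.exp x) x := fun x =>
    (hasDerivAt_normSq (hasDerivAt_airyG lam x)).mul (Real.hasDerivAt_exp x)
  have hanti : AntitoneOn (fun s => normSq (airyG lam s) * Real.exp s) (Ici 100) := by
    refine antitoneOn_of_deriv_nonpos (convex_Ici 100)
      (fun x _ => (hd x).continuousAt.continuousWithinAt)
      (fun x _ => (hd x).differentiableAt.differentiableWithinAt) fun x hx => ?_
    have hx' := mem_Ici.1 (interior_subset hx)
    have := re_pairing_le_of_airyEnergy_nonpos hx' (airyEnergy_nonpos hlam hx')
    rw [(hd x).deriv, ← add_mul]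
    exact mul_nonpos_of_nonpos_of_nonneg (by linarith) (Real.exp_pos x).le
  have h := hanti hu (hu.trans huz : 100 ≤ z) huz
  simp only [normSq_eq_norm_sq] at h
  have e : Real.exp (-(z - u)) = Real.exp u / Real.exp z := by
    rw [← Real.exp_sub]; ring_nf
  rw [e, ← mul_div_assoc, le_div_iff₀ (Real.exp_pos z)]
  exact h


/-! ### The Volterra equation -/

theorem tail_inv_sq {κ s : ℝ} (hκ : 0 ≤ κ) (hs : 0 < s) :
    IntegrableOn (fun z : ℝ => κ / z ^ 2) (Ioi s) ∧ ∫ z in Ioi s, κ / z ^ 2 = κ / s := by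
  have hd : ∀ x ∈ Ici s, HasDerivAt (fun x : ℝ => -(κ * x⁻¹)) (κ / x ^ 2) x := fun x hx => by
    have hx0 : x ≠ 0 := (hs.trans_le hx).ne'
    refine ((hasDerivAt_inv hx0).const_mul κ).neg.congr_deriv ?_
    field_simp
  have hpos : ∀ x ∈ Ioi s, 0 ≤ κ / x ^ 2 := fun x _ => by positivity
  have ht : Filter.Tendsto (fun x : ℝ => -(κ * x⁻¹)) Filter.atTop (nhds 0) := by
    simpa using (tendsto_inv_atTop_zero.const_mul κ).neg
  refine ⟨integrableOn_Ioi_deriv_of_nonneg' hd hpos ht, ?_⟩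
  rw [integral_Ioi_of_hasDerivAt_of_nonneg' hd hpos ht]
  simp [div_eq_mul_inv]

theorem tail_exp (u : ℝ) :
    IntegrableOn (fun z : ℝ => Real.exp (-(z - u))) (Ioi u) ∧
      ∫ z in Ioi u, Real.exp (-(z - u)) = 1 := by
  have e : (fun z : ℝ => Real.exp (-(z - u))) = fun z => Real.exp u * Real.exp (-z) := by
    funext z; rw [← Real.exp_add]; ring_nf
  rw [e]
  constructor
  · have := exp_neg_integrableOn_Ioi u one_pos
    simp only [neg_mul, one_mul] at this
    exact this.const_mul _
  · rw [integral_const_mul, integral_exp_neg_Ioi, ← Real.exp_add]; simp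

theorem hasDerivAt_tail_integral {φ : ℝ → ℂ} {a u : ℝ} (hc : ContinuousOn φ (Ioi a))
    (hi : ∀ s, a < s → IntegrableOn φ (Ioi s)) (hu : a < u) :
    HasDerivAt (fun u => ∫ z in Ioi u, φ z) (-φ u) u := by
  obtain ⟨b, hab, hbu⟩ := exists_between hu
  have hsub : ∀ x, b < x → Icc b x ⊆ Ioi a := fun x _ y hy => lt_of_lt_of_le hab hy.1
  have hd : HasDerivAt (fun u => (∫ z in Ioi b, φ z) - ∫ z in b..u, φ z) (-φ u) u := by
    have h1 : IntervalIntegrable φ volume b u := by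
      apply ContinuousOn.intervalIntegrable
      rw [uIcc_of_le hbu.le]
      exact hc.mono (hsub u hbu)
    exact (intervalIntegral.integral_hasDerivAt_right h1
      (hc.stronglyMeasurableAtFilter isOpen_Ioi u hu)
      (hc.continuousAt (Ioi_mem_nhds hu))).const_sub _
  refine hd.congr_of_eventuallyEq ?_
  filter_upwards [Ioi_mem_nhds hbu] with x hx
  rw [← intervalIntegral.integral_interval_add_Ioi (hi b hab) (hi x (hab.trans hx))]
  ring

/-- `G` is continuous, and on `[a, ∞)` it is nonzero and `|G|²` decays at unit exponential rate. -/
structure DecayingOn (G : ℝ → ℂ) (a : ℝ) : Prop where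
  continuous : Continuous G
  ne_zero : ∀ s, a ≤ s → G s ≠ 0
  decay : ∀ u z, a ≤ u → u ≤ z → ‖G z‖ ^ 2 ≤ ‖G u‖ ^ 2 * Real.exp (-(z - u))

/-- The inner integral `∫ᵤ^∞ G(z)² κ / z² y(z) dz`. -/
def innerTail (G : ℝ → ℂ) (κ : ℝ) (y : ℝ → ℂ) (u : ℝ) : ℂ :=
  ∫ z in Ioi u, G z ^ 2 * ((κ / z ^ 2 : ℝ) : ℂ) * y z

/-- The Volterra operator `∫ₛ^∞ G(u)⁻² ∫ᵤ^∞ G(z)² κ / z² y(z) dz du`. -/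
def volterraOp (G : ℝ → ℂ) (κ : ℝ) (y : ℝ → ℂ) (s : ℝ) : ℂ :=
  ∫ u in Ioi s, innerTail G κ y u / G u ^ 2

/-- The kernel of the Volterra operator after exchanging the integrals. -/
def decayKernel (G : ℝ → ℂ) (κ s z : ℝ) : ℂ :=
  (∫ u in s..z, G z ^ 2 / G u ^ 2) * ((κ / z ^ 2 : ℝ) : ℂ)

section Volterra

variable {G : ℝ → ℂ} {a κ : ℝ}

theorem continuousOn_weight (κ : ℝ) {a : ℝ} (ha : 0 < a) :
    ContinuousOn (fun z : ℝ => ((κ / z ^ 2 : ℝ) : ℂ)) (Ioi a) := by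
  refine Complex.continuous_ofReal.comp_continuousOn (continuousOn_const.div (by fun_prop) ?_)
  intro x hx
  have : 0 < x := ha.trans hx
  positivity

theorem norm_weight (hκ : 0 ≤ κ) (z : ℝ) : ‖((κ / z ^ 2 : ℝ) : ℂ)‖ = κ / z ^ 2 := by
  rw [Complex.norm_real, Real.norm_of_nonneg (by positivity)]

theorem continuousOn_innerTail_integrand (hG : DecayingOn G a) (ha : 0 < a) (κ : ℝ) {y : ℝ → ℂ}
    (hy : Continuous y) :
    ContinuousOn (fun z => G z ^ 2 * ((κ / z ^ 2 : ℝ) : ℂ) * y z) (Ioi a) :=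
  ((hG.continuous.pow 2).continuousOn.mul (continuousOn_weight κ ha)).mul hy.continuousOn

theorem norm_innerTail_integrand_le (hG : DecayingOn G a) (ha : 0 < a) (hκ : 0 ≤ κ) {y : ℝ → ℂ}
    {M : ℝ} (hM : ∀ s, ‖y s‖ ≤ M) {u z : ℝ} (hu : a ≤ u) (hz : u ≤ z) :
    ‖G z ^ 2 * ((κ / z ^ 2 : ℝ) : ℂ) * y z‖
      ≤ ‖G u‖ ^ 2 * (κ / u ^ 2 * M) * Real.exp (-(z - u)) := by
  have hu0 : 0 < u := ha.trans_le hu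
  rw [norm_mul, norm_mul, norm_pow, norm_weight hκ]
  calc ‖G z‖ ^ 2 * (κ / z ^ 2) * ‖y z‖
      ≤ (‖G u‖ ^ 2 * Real.exp (-(z - u))) * (κ / u ^ 2) * M := by
        gcongr
        · exact hG.decay u z hu hz
        · exact hM z
    _ = _ := by ring

theorem integrableOn_innerTail (hG : DecayingOn G a) (ha : 0 < a) (hκ : 0 ≤ κ) {y : ℝ → ℂ}
    (hy : Continuous y) {M : ℝ} (hM : ∀ s, ‖y s‖ ≤ M) {u : ℝ} (hu : a ≤ u) :
    IntegrableOn (fun z => G z ^ 2 * ((κ / z ^ 2 : ℝ) : ℂ) * y z) (Ioi u) := by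
  refine ((tail_exp u).1.const_mul (‖G u‖ ^ 2 * (κ / u ^ 2 * M))).mono'
    (((continuousOn_innerTail_integrand hG ha κ hy).mono
      (Ioi_subset_Ioi hu)).aestronglyMeasurable measurableSet_Ioi) ?_
  filter_upwards [ae_restrict_mem measurableSet_Ioi] with z hz
  exact norm_innerTail_integrand_le hG ha hκ hM hu (le_of_lt hz)

/-- Unit-rate decay makes the exponential tail integrate to $1$. The remaining factor $|G(u)|^2$ is
what the division in the Volterra operator cancels, leaving the integrable $\kappa M/u^2$. -/
theorem norm_innerTail_le (hG : DecayingOn G a) (ha : 0 < a) (hκ : 0 ≤ κ) {y : ℝ → ℂ}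
    {M : ℝ} (hM : ∀ s, ‖y s‖ ≤ M) {u : ℝ} (hu : a ≤ u) :
    ‖innerTail G κ y u‖ ≤ ‖G u‖ ^ 2 * (κ / u ^ 2 * M) := by
  refine (norm_integral_le_of_norm_le
    ((tail_exp u).1.const_mul (‖G u‖ ^ 2 * (κ / u ^ 2 * M))) ?_).trans_eq ?_
  · filter_upwards [ae_restrict_mem measurableSet_Ioi] with z hz
    exact norm_innerTail_integrand_le hG ha hκ hM hu (le_of_lt hz)
  · rw [integral_const_mul, (tail_exp u).2, mul_one]

theorem norm_innerTail_div_le (hG : DecayingOn G a) (ha : 0 < a) (hκ : 0 ≤ κ) {y : ℝ → ℂ}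
    {M : ℝ} (hM : ∀ s, ‖y s‖ ≤ M) {u : ℝ} (hu : a ≤ u) :
    ‖innerTail G κ y u / G u ^ 2‖ ≤ κ * M / u ^ 2 := by
  have hne := norm_pos_iff.2 (hG.ne_zero u hu)
  rw [norm_div, norm_pow, div_le_iff₀ (by positivity)]
  exact (norm_innerTail_le hG ha hκ hM hu).trans_eq (by ring)

theorem hasDerivAt_innerTail (hG : DecayingOn G a) (ha : 0 < a) (hκ : 0 ≤ κ) {y : ℝ → ℂ}
    (hy : Continuous y) {M : ℝ} (hM : ∀ s, ‖y s‖ ≤ M) {u : ℝ} (hu : a < u) :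
    HasDerivAt (innerTail G κ y) (-(G u ^ 2 * ((κ / u ^ 2 : ℝ) : ℂ) * y u)) u :=
  hasDerivAt_tail_integral (continuousOn_innerTail_integrand hG ha κ hy)
    (fun _ hs => integrableOn_innerTail hG ha hκ hy hM hs.le) hu

theorem continuousOn_innerTail_div (hG : DecayingOn G a) (ha : 0 < a) (hκ : 0 ≤ κ) {y : ℝ → ℂ}
    (hy : Continuous y) {M : ℝ} (hM : ∀ s, ‖y s‖ ≤ M) :
    ContinuousOn (fun u => innerTail G κ y u / G u ^ 2) (Ioi a) :=
  ContinuousOn.div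
    (fun _ hu => (hasDerivAt_innerTail hG ha hκ hy hM hu).continuousAt.continuousWithinAt)
    (hG.continuous.pow 2).continuousOn fun u hu => pow_ne_zero 2 (hG.ne_zero u (le_of_lt hu))

theorem integrableOn_innerTail_div (hG : DecayingOn G a) (ha : 0 < a) (hκ : 0 ≤ κ) {y : ℝ → ℂ}
    (hy : Continuous y) {M : ℝ} (hM : ∀ s, ‖y s‖ ≤ M) {s : ℝ} (hs : a ≤ s) :
    IntegrableOn (fun u => innerTail G κ y u / G u ^ 2) (Ioi s) := by
  have hM0 : 0 ≤ M := (norm_nonneg _).trans (hM 0)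
  refine (tail_inv_sq (mul_nonneg hκ hM0) (ha.trans_le hs)).1.mono'
    (((continuousOn_innerTail_div hG ha hκ hy hM).mono
      (Ioi_subset_Ioi hs)).aestronglyMeasurable measurableSet_Ioi) ?_
  filter_upwards [ae_restrict_mem measurableSet_Ioi] with u hu
  exact norm_innerTail_div_le hG ha hκ hM (hs.trans (le_of_lt hu))

theorem norm_volterraOp_le (hG : DecayingOn G a) (ha : 0 < a) (hκ : 0 ≤ κ) {y : ℝ → ℂ}
    {M : ℝ} (hM : ∀ s, ‖y s‖ ≤ M) {s : ℝ} (hs : a ≤ s) :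
    ‖volterraOp G κ y s‖ ≤ κ * M / s := by
  have hM0 : 0 ≤ M := (norm_nonneg _).trans (hM 0)
  have ht := tail_inv_sq (mul_nonneg hκ hM0) (ha.trans_le hs)
  refine (norm_integral_le_of_norm_le ht.1 ?_).trans_eq ht.2
  filter_upwards [ae_restrict_mem measurableSet_Ioi] with u hu
  exact norm_innerTail_div_le hG ha hκ hM (hs.trans (le_of_lt hu))

theorem hasDerivAt_volterraOp (hG : DecayingOn G a) (ha : 0 < a) (hκ : 0 ≤ κ) {y : ℝ → ℂ}
    (hy : Continuous y) {M : ℝ} (hM : ∀ s, ‖y s‖ ≤ M) {s : ℝ} (hs : a < s) :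
    HasDerivAt (volterraOp G κ y) (-(innerTail G κ y s / G s ^ 2)) s :=
  hasDerivAt_tail_integral (continuousOn_innerTail_div hG ha hκ hy hM)
    (fun _ hs => integrableOn_innerTail_div hG ha hκ hy hM hs.le) hs

theorem volterraOp_sub (hG : DecayingOn G a) (ha : 0 < a) (hκ : 0 ≤ κ) {y₁ y₂ : ℝ → ℂ}
    (hy₁ : Continuous y₁) {M₁ : ℝ} (hM₁ : ∀ s, ‖y₁ s‖ ≤ M₁)
    (hy₂ : Continuous y₂) {M₂ : ℝ} (hM₂ : ∀ s, ‖y₂ s‖ ≤ M₂) {s : ℝ} (hs : a ≤ s) :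
    volterraOp G κ y₁ s - volterraOp G κ y₂ s = volterraOp G κ (fun z => y₁ z - y₂ z) s := by
  rw [volterraOp, volterraOp, ← integral_sub (integrableOn_innerTail_div hG ha hκ hy₁ hM₁ hs)
    (integrableOn_innerTail_div hG ha hκ hy₂ hM₂ hs)]
  refine setIntegral_congr_fun measurableSet_Ioi fun u hu => ?_
  have hu' : a ≤ u := hs.trans (le_of_lt hu)
  rw [← sub_div, innerTail, innerTail, innerTail,
    ← integral_sub (integrableOn_innerTail hG ha hκ hy₁ hM₁ hu')
      (integrableOn_innerTail hG ha hκ hy₂ hM₂ hu')]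
  congr 2
  funext z
  ring

/-- The bounded continuous solution of `y = 1 + volterraOp y`. -/
theorem exists_volterra_solution (hG : DecayingOn G a) (ha : 0 < a) (hκ : 0 ≤ κ)
    (hκa : 4 * κ ≤ a) : ∃ y : ℝ → ℂ, Continuous y ∧ (∃ M, ∀ s, ‖y s‖ ≤ M) ∧
      ∀ s, a + 1 ≤ s → y s = 1 + volterraOp G κ y s := by
  have hL : ∀ {y : ℝ → ℂ} {M : ℝ}, (∀ s, ‖y s‖ ≤ M) → ∀ s, a ≤ s →
      ‖volterraOp G κ y s‖ ≤ M / 4 := fun {y M} hM s hs => by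
    have hM0 : 0 ≤ M := (norm_nonneg _).trans (hM 0)
    refine (norm_volterraOp_le hG ha hκ hM hs).trans ?_
    rw [div_le_iff₀ (ha.trans_le hs)]
    nlinarith
  -- Freezing the argument at $a+1$ lets the operator act on bounded continuous functions on all of
  -- $\mathbb R$. The margin $1$ is there because continuity is known only on the open half-line
  -- beyond $a$.
  have hmax : ∀ s : ℝ, a < max s (a + 1) := fun s => lt_max_of_lt_right (lt_add_one a)
  let T : BoundedContinuousFunction ℝ ℂ → BoundedContinuousFunction ℝ ℂ := fun y =>
    BoundedContinuousFunction.ofNormedAddCommGroup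
      (fun s => 1 + volterraOp G κ y (max s (a + 1)))
      (continuous_const.add (continuous_iff_continuousAt.2 fun s =>
        ContinuousAt.comp (f := fun s => max s (a + 1))
          (hasDerivAt_volterraOp hG ha hκ y.continuous y.norm_coe_le_norm
            (hmax s)).continuousAt (by fun_prop)))
      (1 + ‖y‖ / 4) fun s => (norm_add_le _ _).trans
        (add_le_add (by simp) (hL y.norm_coe_le_norm _ (hmax s).le))
  have hT : ContractingWith (1 / 4) T := by
    refine ⟨?_, LipschitzWith.of_dist_le_mul fun y₁ y₂ => ?_⟩
    · rw [← NNReal.coe_lt_coe]; norm_num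
    · refine (BoundedContinuousFunction.dist_le (by positivity)).2 fun s => ?_
      have e : T y₁ s - T y₂ s = volterraOp G κ (fun z => y₁ z - y₂ z) (max s (a + 1)) := by
        rw [← volterraOp_sub hG ha hκ y₁.continuous y₁.norm_coe_le_norm y₂.continuous
          y₂.norm_coe_le_norm (hmax s).le]
        exact add_sub_add_left_eq_sub _ _ _
      rw [dist_eq_norm, e]
      refine (hL (M := dist y₁ y₂) (fun z => ?_) _ (hmax s).le).trans_eq ?_
      · rw [← dist_eq_norm]; exact BoundedContinuousFunction.dist_coe_le_dist z
      · push_cast; ring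
  set y := ContractingWith.fixedPoint T hT with hy
  refine ⟨y, y.continuous, ⟨_, y.norm_coe_le_norm⟩, fun s hs => ?_⟩
  have h := DFunLike.congr_fun (ContractingWith.fixedPoint_isFixedPt hT) s
  rw [← hy] at h
  rw [← h]
  change 1 + volterraOp G κ y (max s (a + 1)) = _
  rw [max_eq_left hs]

/-! ### Exchange of the two integrals and uniqueness for the Volterra equation -/

theorem intervalIntegrable_inv_sq (hG : DecayingOn G a) (c : ℂ) {s z : ℝ} (hs : a ≤ s)
    (hz : s ≤ z) : IntervalIntegrable (fun u => c / G u ^ 2) volume s z := by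
  apply ContinuousOn.intervalIntegrable
  rw [uIcc_of_le hz]
  exact continuousOn_const.div (hG.continuous.pow 2).continuousOn fun u hu =>
    pow_ne_zero 2 (hG.ne_zero u (hs.trans hu.1))

theorem norm_inner_kernel_le (hG : DecayingOn G a) {s z : ℝ} (hs : a ≤ s) (hz : s ≤ z) :
    ‖∫ u in s..z, G z ^ 2 / G u ^ 2‖ ≤ 1 := by
  have h1 : ‖∫ u in s..z, G z ^ 2 / G u ^ 2‖ ≤ ∫ u in s..z, Real.exp (-z) * Real.exp u := by
    refine intervalIntegral.norm_integral_le_of_norm_le hz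
      (Filter.Eventually.of_forall fun u hu => ?_) (by
        apply Continuous.intervalIntegrable; fun_prop)
    have hne := norm_pos_iff.2 (hG.ne_zero u (hs.trans hu.1.le))
    rw [norm_div, norm_pow, norm_pow, div_le_iff₀ (by positivity)]
    refine (hG.decay u z (hs.trans hu.1.le) hu.2).trans_eq ?_
    rw [mul_comm, ← Real.exp_add]
    ring_nf
  refine h1.trans ?_
  rw [intervalIntegral.integral_const_mul, integral_exp, mul_sub, ← Real.exp_add]
  simp [(mul_pos (Real.exp_pos (-z)) (Real.exp_pos s)).le]

theorem norm_decayKernel_le (hG : DecayingOn G a) (hκ : 0 ≤ κ) {s z : ℝ} (hs : a ≤ s)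
    (hz : s ≤ z) : ‖decayKernel G κ s z‖ ≤ κ / z ^ 2 := by
  rw [decayKernel, norm_mul, norm_weight hκ]
  exact mul_le_of_le_one_left (by positivity) (norm_inner_kernel_le hG hs hz)

theorem inner_kernel_eq (G : ℝ → ℂ) (s z : ℝ) :
    ∫ u in s..z, G z ^ 2 / G u ^ 2 = G z ^ 2 * ∫ u in s..z, 1 / G u ^ 2 := by
  rw [← intervalIntegral.integral_const_mul]
  simp only [mul_one_div]

theorem hasDerivAt_integral_inv_sq (hG : DecayingOn G a) {s z : ℝ} (hs : a < s) (hz : s ≤ z) :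
    HasDerivAt (fun z => ∫ u in s..z, 1 / G u ^ 2) (1 / G z ^ 2) z := by
  have hc : ContinuousOn (fun u => 1 / G u ^ 2) (Ioi a) :=
    continuousOn_const.div (hG.continuous.pow 2).continuousOn fun u hu =>
      pow_ne_zero 2 (hG.ne_zero u (le_of_lt hu))
  exact intervalIntegral.integral_hasDerivAt_right (intervalIntegrable_inv_sq hG 1 hs.le hz)
    (hc.stronglyMeasurableAtFilter isOpen_Ioi z (hs.trans_le hz))
    (hc.continuousAt (Ioi_mem_nhds (hs.trans_le hz)))

theorem continuousOn_decayKernel (hG : DecayingOn G a) (ha : 0 < a) (κ : ℝ) {s : ℝ} (hs : a < s) :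
    ContinuousOn (decayKernel G κ s) (Ioi s) := by
  have h : ContinuousOn (fun z => (G z ^ 2 * ∫ u in s..z, 1 / G u ^ 2) * ((κ / z ^ 2 : ℝ) : ℂ))
      (Ioi s) := by
    refine ((hG.continuous.pow 2).continuousOn.mul fun z hz =>
      (hasDerivAt_integral_inv_sq hG hs (le_of_lt hz)).continuousAt.continuousWithinAt).mul
      ((continuousOn_weight κ ha).mono (Ioi_subset_Ioi hs.le))
  exact h.congr fun z _ => by rw [decayKernel, inner_kernel_eq]

theorem integrableOn_decayKernel_mul (hG : DecayingOn G a) (ha : 0 < a) (hκ : 0 ≤ κ) {y : ℝ → ℂ}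
    (hy : Continuous y) {M : ℝ} (hM : ∀ s, ‖y s‖ ≤ M) {s : ℝ} (hs : a < s) :
    IntegrableOn (fun z => decayKernel G κ s z * y z) (Ioi s) := by
  have hM0 : 0 ≤ M := (norm_nonneg _).trans (hM 0)
  refine ((tail_inv_sq hκ (ha.trans hs)).1.mul_const M).mono'
    (((continuousOn_decayKernel hG ha κ hs).mul hy.continuousOn).aestronglyMeasurable
      measurableSet_Ioi) ?_
  filter_upwards [ae_restrict_mem measurableSet_Ioi] with z hz
  rw [norm_mul]
  have := norm_decayKernel_le hG hκ hs.le (le_of_lt hz)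
  gcongr
  exact hM z

/-- Integration by parts replaces Fubini: with $B(z)=\int_s^zG^{-2}$, the product of $B$ and the
inner tail vanishes at $z=s$ and tends to $0$ at infinity, being bounded by $\kappa M/z^2$. -/
theorem integral_decayKernel_mul (hG : DecayingOn G a) (ha : 0 < a) (hκ : 0 ≤ κ) {y : ℝ → ℂ}
    (hy : Continuous y) {M : ℝ} (hM : ∀ s, ‖y s‖ ≤ M) {s : ℝ} (hs : a < s) :
    ∫ z in Ioi s, decayKernel G κ s z * y z = volterraOp G κ y s := by
  have hi₁ := integrableOn_innerTail_div hG ha hκ hy hM hs.le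
  have hi₂ := integrableOn_decayKernel_mul hG ha hκ hy hM hs
  set B : ℝ → ℂ := fun z => ∫ u in s..z, 1 / G u ^ 2 with hB
  have hd : ∀ z, s ≤ z → HasDerivAt (fun z => B z * innerTail G κ y z)
      (innerTail G κ y z / G z ^ 2 - decayKernel G κ s z * y z) z := fun z hz => by
    refine ((hasDerivAt_integral_inv_sq hG hs hz).mul
      (hasDerivAt_innerTail hG ha hκ hy hM (hs.trans_le hz))).congr_deriv ?_
    rw [decayKernel, inner_kernel_eq]
    ring
  have ht : Filter.Tendsto (fun z => B z * innerTail G κ y z) Filter.atTop (nhds 0) := by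
    have hlim : Filter.Tendsto (fun z : ℝ => κ * M * (z⁻¹) ^ 2) Filter.atTop (nhds 0) := by
      simpa using ((tendsto_inv_atTop_zero (𝕜 := ℝ)).pow 2).const_mul (κ * M)
    refine squeeze_zero_norm' ?_ hlim
    filter_upwards [Filter.eventually_ge_atTop s] with z hz
    have hne : G z ^ 2 ≠ 0 := pow_ne_zero 2 (hG.ne_zero z (hs.le.trans hz))
    have e : B z * innerTail G κ y z
        = (∫ u in s..z, G z ^ 2 / G u ^ 2) * (innerTail G κ y z / G z ^ 2) := by
      rw [inner_kernel_eq]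
      calc B z * innerTail G κ y z = B z * (innerTail G κ y z * (G z ^ 2 / G z ^ 2)) := by
            rw [div_self hne, mul_one]
        _ = _ := by ring
    rw [e, norm_mul]
    refine (mul_le_of_le_one_left (norm_nonneg _) (norm_inner_kernel_le hG hs.le hz)).trans
      ((norm_innerTail_div_le hG ha hκ hM (hs.le.trans hz)).trans_eq ?_)
    rw [inv_pow, div_eq_mul_inv]
  have h := integral_Ioi_of_hasDerivAt_of_tendsto (hd s le_rfl).continuousAt.continuousWithinAt
    (fun z hz => hd z (le_of_lt hz)) (hi₁.sub hi₂) ht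
  have hBs : B s = 0 := intervalIntegral.integral_same
  rw [integral_sub hi₁ hi₂, hBs, zero_mul, sub_zero, sub_eq_zero] at h
  exact h.symm

end Volterra

/-- The kernel is bounded by $\gamma(\gamma+1)/z^2$, whose tail is at most $1/4$, so the essential
supremum $M$ of the difference satisfies $M\le M/4$. -/
theorem IsVolterraFixedPoint.ae_eq {γ : ℝ} {lam : ℂ} {s₀ : ℝ} (hγ : 0 ≤ γ * (γ + 1))
    (hs₀ : 0 < s₀) (hγs : 4 * (γ * (γ + 1)) ≤ s₀) (hG : DecayingOn (airyG lam) s₀)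
    {Q R : ℝ → ℂ} (hQ : IsVolterraFixedPoint γ lam s₀ Q) (hR : IsVolterraFixedPoint γ lam s₀ R) :
    ∀ᵐ s ∂(volume.restrict (Ici s₀)), Q s = R s := by
  set μ := (volume : Measure ℝ).restrict (Ici s₀) with hμ
  have hmem := hQ.bounded.sub hR.bounded
  have hfin : eLpNormEssSup (Q - R) μ ≠ ⊤ := by
    rw [← eLpNorm_exponent_top]; exact hmem.2.ne
  set M := (eLpNormEssSup (Q - R) μ).toReal with hM
  have hM0 : 0 ≤ M := ENNReal.toReal_nonneg
  have hb : ∀ᵐ s ∂μ, ‖Q s - R s‖ ≤ M := by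
    filter_upwards [ae_le_eLpNormEssSup (f := Q - R) (μ := μ)] with s hs
    have := ENNReal.toReal_mono hfin hs
    simpa using this
  have hc : ∀ᵐ s ∂μ, ‖(Q - R) s‖ ≤ M / 4 := by
    filter_upwards [hQ.fixed, hR.fixed, ae_restrict_mem measurableSet_Ici] with s hQs hRs hs
    have hs' : s₀ ≤ s := hs
    rw [Pi.sub_apply, hQs.2, hRs.2, ← integral_sub hQs.1 hRs.1]
    have ht := tail_inv_sq hγ (hs₀.trans_le hs')
    refine (norm_integral_le_of_norm_le (ht.1.mul_const M) ?_).trans ?_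
    · have hb' := ae_restrict_of_ae_restrict_of_subset
        ((Ioi_subset_Ici_self).trans (Ici_subset_Ici.2 hs')) hb
      filter_upwards [hb', ae_restrict_mem measurableSet_Ioi] with z hz hsz
      rw [← mul_sub, add_sub_add_left_eq_sub, norm_mul]
      have : ‖volterraKernel γ lam s z‖ ≤ γ * (γ + 1) / z ^ 2 :=
        norm_decayKernel_le hG hγ hs' (le_of_lt hsz)
      gcongr
    · rw [integral_mul_const, ht.2, div_mul_eq_mul_div, div_le_iff₀ (hs₀.trans_le hs')]
      nlinarith
  have hle : M ≤ M / 4 := by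
    have := ENNReal.toReal_mono ENNReal.ofReal_ne_top (eLpNormEssSup_le_of_ae_bound hc)
    rwa [ENNReal.toReal_ofReal (by positivity)] at this
  filter_upwards [hb] with s hs
  exact sub_eq_zero.1 (norm_le_zero_iff.1 (hs.trans (by linarith)))


/-! ### The decaying solution and the connection with the Frobenius basis -/

theorem decayingOn_airyG {lam : ℂ} (hlam : ‖lam‖ ≤ 1 / 4) {a : ℝ} (ha : 100 ≤ a) :
    DecayingOn (airyG lam) a where
  continuous := continuous_iff_continuousAt.2 fun s => (hasDerivAt_airyG lam s).continuousAt
  ne_zero _ hs := airyG_ne_zero hlam (ha.trans hs)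
  decay _ _ hu huz := norm_airyG_sq_le hlam (ha.trans hu) huz

/-- The product of the Airy function with a solution of the Volterra equation is a decaying
solution of the model equation. -/
theorem solvesOn_airyG_mul {γ : ℝ} (hγ : 1 / 2 < γ) {lam : ℂ} (hlam : ‖lam‖ ≤ 1 / 4) {a : ℝ}
    (ha : 100 ≤ a) {y : ℝ → ℂ} (hy : Continuous y) {M : ℝ} (hM : ∀ s, ‖y s‖ ≤ M)
    (hfix : ∀ s, a ≤ s → y s = 1 + volterraOp (airyG lam) (γ * (γ + 1)) y s) :
    ∃ (h' : ℝ → ℂ) (C : ℝ),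
      SolvesOn (modelPotential γ lam) (Ioi a) (fun s => airyG lam s * y s) h' ∧
      (∀ s, a < s → ‖airyG lam s * y s‖ ≤ C * Real.exp (-s) ∧ ‖h' s‖ ≤ C * Real.exp (-s)) ∧
      ∃ s, a < s ∧ airyG lam s * y s ≠ 0 := by
  have hG := decayingOn_airyG hlam ha
  have ha0 : 0 < a := by linarith
  have hκ : 0 ≤ γ * (γ + 1) := by positivity
  have hM0 : 0 ≤ M := (norm_nonneg _).trans (hM 0)
  set K := innerTail (airyG lam) (γ * (γ + 1)) y with hK
  have hyd : ∀ s, a < s → HasDerivAt y (-(K s / airyG lam s ^ 2)) s := fun s hs => by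
    refine ((hasDerivAt_volterraOp hG ha0 hκ hy hM hs).const_add 1).congr_of_eventuallyEq ?_
    filter_upwards [Ioi_mem_nhds hs] with t ht
    exact hfix t (le_of_lt ht)
  -- Since $y'=-K/G^2$, this is $(Gy)'$. In its derivative the terms $G'K/G^2$ cancel, and $-K'/G$
  -- supplies the inverse-square potential.
  refine ⟨fun s => airyGDeriv lam s * y s - K s / airyG lam s,
    Real.exp 7 * (M + γ * (γ + 1) * M), fun s hs => ⟨?_, ?_⟩, fun s hs => ⟨?_, ?_⟩, ?_⟩
  · have hne := hG.ne_zero s (le_of_lt hs)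
    refine ((hasDerivAt_airyG lam s).mul (hyd s hs)).congr_deriv ?_
    field_simp
    ring
  · have hne := hG.ne_zero s (le_of_lt hs)
    refine (((hasDerivAt_airyGDeriv lam s).mul (hyd s hs)).sub
      ((hasDerivAt_innerTail hG ha0 hκ hy hM hs).div (hasDerivAt_airyG lam s) hne)).congr_deriv ?_
    rw [← hK, modelPotential]
    field_simp
    ring
  · have hs1 : 1 ≤ s := by linarith
    have h1 := norm_airyG_le (hlam.trans (by norm_num)) hs1
    rw [norm_mul]
    calc ‖airyG lam s‖ * ‖y s‖ ≤ Real.exp (7 - s) * M := by gcongr; exact hM s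
      _ = Real.exp 7 * M * Real.exp (-s) := by rw [sub_eq_add_neg, Real.exp_add]; ring
      _ ≤ _ := by
        gcongr
        exact le_add_of_nonneg_right (mul_nonneg hκ hM0)
  · have hs1 : 1 ≤ s := by linarith
    have hne := hG.ne_zero s hs.le
    have h1 := norm_airyG_le (hlam.trans (by norm_num)) hs1
    have h2 := norm_airyGDeriv_le (hlam.trans (by norm_num)) hs1
    have h3 : ‖K s / airyG lam s ^ 2‖ ≤ γ * (γ + 1) * M :=
      (norm_innerTail_div_le hG ha0 hκ hM hs.le).trans
        (div_le_self (mul_nonneg hκ hM0) (by nlinarith))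
    have e : K s / airyG lam s = airyG lam s * (K s / airyG lam s ^ 2) := by
      field_simp
    simp only
    rw [e]
    calc ‖airyGDeriv lam s * y s - airyG lam s * (K s / airyG lam s ^ 2)‖
        ≤ Real.exp (7 - s) * M + Real.exp (7 - s) * (γ * (γ + 1) * M) := by
          refine (norm_sub_le _ _).trans ?_
          rw [norm_mul, norm_mul]
          gcongr
          exact hM s
      _ = _ := by rw [sub_eq_add_neg, Real.exp_add]; ring
  · by_contra! hzero
    -- Beyond $\gamma(\gamma+1)M$ the Volterra term has modulus less than $1$, so $y$ cannot vanish.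
    set s := a + γ * (γ + 1) * M + 1 with hs
    have hκM : 0 ≤ γ * (γ + 1) * M := mul_nonneg hκ hM0
    have has : a < s := by linarith
    have hy0 : y s = 0 := (mul_eq_zero.1 (hzero s has)).resolve_left (hG.ne_zero s has.le)
    have h1 := hfix s has.le
    have h2 := norm_volterraOp_le hG ha0 hκ hM has.le
    rw [eq_neg_of_add_eq_zero_right (h1.symm.trans hy0), norm_neg, norm_one,
      le_div_iff₀ (ha0.trans has)] at h2
    linarith

/-- A solution that is not proportional to a decaying one is not square-integrable. -/
theorem not_sq_integrableOn_of_wronskian_ne_zero {V h h' f g : ℝ → ℂ} {b C : ℝ} (hb : 0 ≤ b)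
    (hh : SolvesOn V (Ioi b) h h') (hf : SolvesOn V (Ioi b) f g)
    (hC : ∀ s, b < s → ‖h s‖ ≤ C * Real.exp (-s) ∧ ‖h' s‖ ≤ C * Real.exp (-s))
    {w : ℂ} (hw : w ≠ 0) (hW : ∀ s, b < s → h s * g s - h' s * f s = w) {t : ℝ} (ht : b < t) :
    ¬ IntegrableOn (fun s => ‖f s‖ ^ 2) (Ioi t) := by
  intro hint
  have hC0 : 0 ≤ C := by
    have := (norm_nonneg _).trans (hC t ht).1
    exact nonneg_of_mul_nonneg_left this (Real.exp_pos _)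
  have hcont : ∀ {S : Set ℝ} {f g : ℝ → ℂ}, SolvesOn V (Ioi b) f g → S ⊆ Ioi b →
      ContinuousOn f S ∧ ContinuousOn g S := fun hf hS =>
    ⟨fun s hs => (hf s (hS hs)).1.continuousAt.continuousWithinAt,
      fun s hs => (hf s (hS hs)).2.continuousAt.continuousWithinAt⟩
  have hsub : Ioi t ⊆ Ioi b := Ioi_subset_Ioi ht.le
  have hi : IntegrableOn (fun s => h' s * f s) (Ioi t) := by
    refine ((((tail_exp t).1.const_mul (C ^ 2 / 2))).add (hint.const_mul (1 / 2))).mono'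
      (((hcont hh hsub).2.mul (hcont hf hsub).1).aestronglyMeasurable measurableSet_Ioi) ?_
    filter_upwards [ae_restrict_mem measurableSet_Ioi] with s hs
    have hs' : t < s := hs
    have h1 : ‖h' s‖ ^ 2 ≤ C ^ 2 * Real.exp (-(s - t)) := by
      calc ‖h' s‖ ^ 2 ≤ (C * Real.exp (-s)) ^ 2 := by gcongr; exact (hC s (hsub hs)).2
        _ = C ^ 2 * Real.exp (-(2 * s)) := by
          rw [mul_pow, ← Real.exp_nat_mul]; push_cast; ring_nf
        _ ≤ C ^ 2 * Real.exp (-(s - t)) := by gcongr; linarith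
    rw [norm_mul]
    simp only [Pi.add_apply]
    nlinarith [sq_nonneg (‖h' s‖ - ‖f s‖)]
  -- From $(hf)'=hf'+h'f=w+2h'f$ with $h'f$ integrable, $hf$ grows linearly while $h$ stays bounded.
  -- So $|f|\ge1$ eventually, against square-integrability.
  have hbound : ∀ T, t ≤ T → ‖w‖ * (T - t) ≤ C * ‖f T‖
      + (‖h t * f t‖ + 2 * ∫ s in Ioi t, ‖h' s * f s‖) := fun T hT => by
    have hIcc : Icc t T ⊆ Ioi b := fun s hs => lt_of_lt_of_le ht hs.1
    have hii : IntervalIntegrable (fun s => h' s * f s) volume t T := by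
      apply ContinuousOn.intervalIntegrable
      rw [uIcc_of_le hT]
      exact (hcont hh hIcc).2.mul (hcont hf hIcc).1
    have h1 := intervalIntegral.integral_eq_sub_of_hasDerivAt (a := t) (b := T)
      (f := fun s => h s * f s) (f' := fun s => w + 2 * (h' s * f s)) (fun s hs => ?_)
      (intervalIntegrable_const.add (hii.const_mul 2))
    · rw [intervalIntegral.integral_add intervalIntegrable_const (hii.const_mul 2),
        intervalIntegral.integral_const, intervalIntegral.integral_const_mul] at h1
      have h2 : ‖∫ s in t..T, h' s * f s‖ ≤ ∫ s in Ioi t, ‖h' s * f s‖ := by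
        rw [intervalIntegral.integral_of_le hT]
        exact (norm_integral_le_integral_norm _).trans (setIntegral_mono_set hi.norm
          (Filter.Eventually.of_forall fun _ => norm_nonneg _)
          (Filter.Eventually.of_forall fun s hs => hs.1))
      have e : (T - t) • w = h T * f T - (h t * f t + 2 * ∫ s in t..T, h' s * f s) := by
        linear_combination h1
      have h3 := congrArg norm e
      rw [norm_smul, Real.norm_of_nonneg (by linarith)] at h3
      rw [mul_comm, h3]
      refine (norm_sub_le _ _).trans (add_le_add ?_ ((norm_add_le _ _).trans ?_))
      · rw [norm_mul]
        gcongr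
        refine (hC T (ht.trans_le hT)).1.trans (mul_le_of_le_one_right hC0 ?_)
        rw [Real.exp_le_one_iff]
        linarith
      · rw [norm_mul 2]
        gcongr
        simp
    · rw [uIcc_of_le hT] at hs
      refine ((hh s (hIcc hs)).1.mul (hf s (hIcc hs)).1).congr_deriv ?_
      linear_combination hW s (hIcc hs)
  set A := ‖h t * f t‖ + 2 * ∫ s in Ioi t, ‖h' s * f s‖ with hA
  have hA0 : 0 ≤ A := add_nonneg (norm_nonneg _)
    (mul_nonneg zero_le_two (integral_nonneg fun _ => norm_nonneg _))
  have hw0 := norm_pos_iff.2 hw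
  set T₁ := t + (C + A) / ‖w‖ with hT₁
  have htT : t ≤ T₁ := by
    have : 0 ≤ (C + A) / ‖w‖ := by positivity
    linarith
  have hone : ∀ T, T₁ < T → 1 ≤ ‖f T‖ ^ 2 := fun T hT => by
    by_contra! hlt
    have hf1 : ‖f T‖ ≤ 1 := by nlinarith [norm_nonneg (f T)]
    have h1 := hbound T (htT.trans hT.le)
    have h2 : (C + A) / ‖w‖ < T - t := by linarith
    rw [div_lt_iff₀ hw0] at h2
    nlinarith
  have hconst : IntegrableOn (fun _ : ℝ => (1 : ℝ)) (Ioi T₁) := by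
    refine (hint.mono_set (Ioi_subset_Ioi htT)).mono' (by fun_prop) ?_
    filter_upwards [ae_restrict_mem measurableSet_Ioi] with s hs
    simpa using hone s hs
  rw [integrableOn_const_iff] at hconst
  simp at hconst

theorem SolvesOn.isModelSolution {γ : ℝ} {lam : ℂ} {f g : ℝ → ℂ}
    (h : SolvesOn (modelPotential γ lam) (Ioi 0) f g) : IsModelSolution γ lam f := by
  intro s hs
  have hev : deriv f =ᶠ[nhds s] g :=
    Filter.eventuallyEq_of_mem (Ioi_mem_nhds hs) fun t ht => (h t ht).1.deriv
  have hd := (h s hs).2.congr_of_eventuallyEq hev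
  refine ⟨(h s hs).1.differentiableAt, hd.differentiableAt, ?_⟩
  have hs0 : (s : ℂ) ≠ 0 := by exact_mod_cast hs.ne'
  rw [hd.deriv, modelPotential]
  push_cast
  field_simp
  ring

theorem SolvesOn.add_const_mul {V f₁ g₁ f₂ g₂ : ℝ → ℂ} {S : Set ℝ} (h₁ : SolvesOn V S f₁ g₁)
    (h₂ : SolvesOn V S f₂ g₂) (c : ℂ) :
    SolvesOn V S (fun s => f₁ s + c * f₂ s) (fun s => g₁ s + c * g₂ s) := fun s hs =>
  ⟨(h₁ s hs).1.add ((h₂ s hs).1.const_mul c),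
    ((h₁ s hs).2.add ((h₂ s hs).2.const_mul c)).congr_deriv (by ring)⟩

theorem SolvesOn.mono {V f g : ℝ → ℂ} {S T : Set ℝ} (h : SolvesOn V S f g) (hT : T ⊆ S) :
    SolvesOn V T f g := fun s hs => h s (hT hs)

/-- Every solution near infinity is a combination of the Frobenius solutions. -/
theorem exists_frobenius_expansion {γ : ℝ} (hγ : 1 / 2 < γ)
    (hres : ∀ k : ℕ, γ ≠ ((k : ℝ) + 1) / 2) {lam : ℂ} {b : ℝ} (hb : 0 ≤ b) {h h' : ℝ → ℂ}
    (hh : SolvesOn (modelPotential γ lam) (Ioi b) h h') :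
    ∃ α β : ℂ, (∀ s, b < s → h s = α * frobeniusSol (-γ) lam s + β * frobeniusSol (γ + 1) lam s ∧
      h' s = α * frobeniusSolDeriv (-γ) lam s + β * frobeniusSolDeriv (γ + 1) lam s) ∧
      ∀ s, b < s → h s * frobeniusSolDeriv (γ + 1) lam s - h' s * frobeniusSol (γ + 1) lam s
        = α * (2 * γ + 1) := by
  obtain ⟨hp, hm⟩ := frobenius_exponent_ne hγ hres
  have h₁ := (frobeniusSol_solvesOn (γ := γ) hp (by ring) lam).mono (Ioi_subset_Ioi hb)
  have h₂ := (frobeniusSol_solvesOn (γ := γ) hm (by ring) lam).mono (Ioi_subset_Ioi hb)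
  have hne : 2 * (γ : ℂ) + 1 ≠ 0 := by
    have : 2 * γ + 1 ≠ 0 := by linarith
    exact_mod_cast this
  have hb1 : b < b + 1 := lt_add_one b
  set W₁ := h (b + 1) * frobeniusSolDeriv (-γ) lam (b + 1)
    - h' (b + 1) * frobeniusSol (-γ) lam (b + 1) with hW₁
  set W₂ := h (b + 1) * frobeniusSolDeriv (γ + 1) lam (b + 1)
    - h' (b + 1) * frobeniusSol (γ + 1) lam (b + 1) with hW₂
  have e₂ : ∀ s, b < s → h s * frobeniusSolDeriv (γ + 1) lam s
      - h' s * frobeniusSol (γ + 1) lam s = W₂ := fun s hs => hh.wronskian_eq h₂ hs hb1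
  -- Cramer's rule, with the Frobenius Wronskian as determinant.
  refine ⟨W₂ / (2 * γ + 1), -W₁ / (2 * γ + 1), fun s hs => ?_, fun s hs => ?_⟩
  · have e := wronskian_frobenius hγ hres lam (hb.trans_lt hs)
    have e₁ : h s * frobeniusSolDeriv (-γ) lam s - h' s * frobeniusSol (-γ) lam s = W₁ :=
      hh.wronskian_eq h₁ hs hb1
    constructor
    · field_simp
      rw [← e, ← e₁, ← e₂ s hs]
      ring
    · field_simp
      rw [← e, ← e₁, ← e₂ s hs]
      ring
  · rw [e₂ s hs]
    field_simp

theorem tendsto_zero_of_norm_le_exp {f : ℝ → ℂ} {b C : ℝ}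
    (h : ∀ s, b < s → ‖f s‖ ≤ C * Real.exp (-s)) : Filter.Tendsto f Filter.atTop (nhds 0) := by
  refine squeeze_zero_norm' ((Filter.eventually_gt_atTop b).mono h) ?_
  simpa using (Real.tendsto_exp_neg_atTop_nhds_zero).const_mul C

/-- The decaying solution has a nonzero component along `s^{-γ} F₊`. -/
theorem frobenius_component_ne_zero {γ : ℝ} (hγ : 1 / 2 < γ)
    (hres : ∀ k : ℕ, γ ≠ ((k : ℝ) + 1) / 2) {lam : ℂ} (hlam : ‖lam‖ ≤ 1 / 4) {b C : ℝ}
    (hb : 0 ≤ b) {h h' : ℝ → ℂ} {α β : ℂ}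
    (hC : ∀ s, b < s → ‖h s‖ ≤ C * Real.exp (-s) ∧ ‖h' s‖ ≤ C * Real.exp (-s))
    (hne : ∃ s, b < s ∧ h s ≠ 0)
    (hexp : ∀ s, b < s →
      h s = α * frobeniusSol (-γ) lam s + β * frobeniusSol (γ + 1) lam s ∧
      h' s = α * frobeniusSolDeriv (-γ) lam s + β * frobeniusSolDeriv (γ + 1) lam s) :
    α ≠ 0 := by
  rintro rfl
  obtain ⟨s, hs, hhs⟩ := hne
  simp only [zero_mul, zero_add] at hexp
  have hβ : β ≠ 0 := by
    rintro rfl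
    simp [(hexp s hs).1] at hhs
  have ht : ∀ {f k : ℝ → ℂ}, (∀ s, b < s → k s = β * f s) →
      (∀ s, b < s → ‖k s‖ ≤ C * Real.exp (-s)) → Filter.Tendsto f Filter.atTop (nhds 0) := by
    intro f k hk hkC
    have h1 := (tendsto_zero_of_norm_le_exp hkC).const_mul β⁻¹
    rw [mul_zero] at h1
    refine h1.congr' ?_
    filter_upwards [Filter.eventually_gt_atTop b] with s hs
    rw [hk s hs, inv_mul_cancel_left₀ hβ]
  obtain ⟨-, hm⟩ := frobenius_exponent_ne hγ hres
  obtain ⟨h0, h0'⟩ := tendsto_frobeniusSol_zero (δ := γ + 1) (by linarith) lam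
  have hz := model_solution_eq_zero hγ hlam
    (frobeniusSol_solvesOn (γ := γ) hm (by ring) lam) h0 h0'
    (ht (fun s hs => (hexp s hs).1) fun s hs => (hC s hs).1)
    (ht (fun s hs => (hexp s hs).2) fun s hs => (hC s hs).2) (hb.trans_lt hs)
  rw [(hexp s hs).1, hz, mul_zero] at hhs
  exact hhs rfl

theorem sq_integrableOn_of_norm_le_exp {f : ℝ → ℂ} {b C : ℝ} (hf : ContinuousOn f (Ioi 0))
    (h : ∀ s, b < s → ‖f s‖ ≤ C * Real.exp (-s)) : IntegrableOn (fun s => ‖f s‖ ^ 2) (Ici 1) := by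
  have hc : ContinuousOn (fun s => ‖f s‖ ^ 2) (Ici 1) :=
    (hf.norm.pow 2).mono fun s hs => mem_Ioi.2 (one_pos.trans_le (mem_Ici.1 hs))
  set t := max 1 b with ht
  have h1 : IntegrableOn (fun s => ‖f s‖ ^ 2) (Icc 1 t) :=
    (hc.mono Icc_subset_Ici_self).integrableOn_Icc
  have h2 : IntegrableOn (fun s => ‖f s‖ ^ 2) (Ioi t) := by
    have hsub : Ioi t ⊆ Ici 1 := fun s hs => mem_Ici.2 ((le_max_left 1 b).trans (mem_Ioi.1 hs).le)
    refine ((tail_exp t).1.const_mul (C ^ 2)).mono'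
      ((hc.mono hsub).aestronglyMeasurable measurableSet_Ioi) ?_
    filter_upwards [ae_restrict_mem measurableSet_Ioi] with s hs
    have hs' : t < s := hs
    have ht1 : 1 ≤ t := le_max_left _ _
    rw [Real.norm_of_nonneg (by positivity)]
    calc ‖f s‖ ^ 2 ≤ (C * Real.exp (-s)) ^ 2 := by
          gcongr; exact h s ((le_max_right _ _).trans_lt hs)
      _ = C ^ 2 * Real.exp (-(2 * s)) := by
          rw [mul_pow, ← Real.exp_nat_mul]; push_cast; ring_nf
      _ ≤ C ^ 2 * Real.exp (-(s - t)) := by gcongr; linarith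
  rw [← Icc_union_Ioi_eq_Ici (le_max_left 1 b)]
  exact h1.union h2

/-- Two normalized square-integrable solutions coincide if `s^{γ+1} F₋` is not square-integrable. -/
theorem IsNormalizedL2Solution.unique {γ : ℝ} {lam : ℂ} {f₁ f₂ : ℝ → ℂ} {c₁ c₂ : ℂ}
    (h₁ : IsNormalizedL2Solution γ lam f₁ c₁) (h₂ : IsNormalizedL2Solution γ lam f₂ c₂)
    (hcont : ContinuousOn (frobeniusSol (γ + 1) lam) (Ioi 0))
    (hnot : ¬ IntegrableOn (fun s => ‖frobeniusSol (γ + 1) lam s‖ ^ 2) (Ici 1)) :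
    EqOn f₁ f₂ (Ioi 0) ∧ c₁ = c₂ := by
  -- Otherwise $s^{\gamma+1}F_-=(f_1-f_2)/(c_1-c_2)$ would be square-integrable.
  have hc : c₁ = c₂ := by
    by_contra hne
    have hne' : c₁ - c₂ ≠ 0 := sub_ne_zero.2 hne
    apply hnot
    have hc : ContinuousOn (fun s => ‖frobeniusSol (γ + 1) lam s‖ ^ 2) (Ici 1) :=
      (hcont.norm.pow 2).mono fun s hs => mem_Ioi.2 (one_pos.trans_le (mem_Ici.1 hs))
    have hn0 := norm_pos_iff.2 hne'
    refine ((h₁.sq_integrable.add h₂.sq_integrable).const_mul (2 / ‖c₁ - c₂‖ ^ 2)).mono'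
      (hc.aestronglyMeasurable measurableSet_Ici) ?_
    filter_upwards [ae_restrict_mem measurableSet_Ici] with s hs
    have hs0 : 0 < s := one_pos.trans_le (mem_Ici.1 hs)
    have e : (c₁ - c₂) * frobeniusSol (γ + 1) lam s = f₁ s - f₂ s := by
      rw [h₁.expansion s hs0, h₂.expansion s hs0, Fminus, frobeniusSol]; ring
    have e' := congrArg norm e
    rw [norm_mul] at e'
    rw [Real.norm_of_nonneg (by positivity), div_mul_eq_mul_div, le_div_iff₀ (by positivity),
      mul_comm, ← mul_pow, e', Pi.add_apply]
    have h3 := norm_sub_le (f₁ s) (f₂ s)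
    calc ‖f₁ s - f₂ s‖ ^ 2 ≤ (‖f₁ s‖ + ‖f₂ s‖) ^ 2 := by gcongr
      _ ≤ _ := by nlinarith [sq_nonneg (‖f₁ s‖ - ‖f₂ s‖)]
  refine ⟨fun s hs => ?_, hc⟩
  rw [h₁.expansion s hs, h₂.expansion s hs, hc]

end FokkerPlanckAiry

end

/-! ### Assembly of the main theorem -/

open FokkerPlanckAiry in
theorem mainTheorem6 (γ : ℝ) (hγ : 1 / 2 < γ) (hres : ∀ k : ℕ, γ ≠ ((k : ℝ) + 1) / 2) :
    ∃ lam₀ : ℝ, 0 < lam₀ ∧ ∃ s₀ : ℝ, 0 < s₀ ∧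
    ∃ (d : ℂ → ℂ) (H : ℂ → ℝ → ℂ) (R : ℂ → ℝ → ℂ), ∀ lam : ℂ, ‖lam‖ ≤ lam₀ →
      -- existence
      FokkerPlanckAiry.IsNormalizedL2Solution γ lam (H lam) (d lam) ∧
      -- uniqueness
      (∀ (f : ℝ → ℂ) (c : ℂ), FokkerPlanckAiry.IsNormalizedL2Solution γ lam f c →
        Set.EqOn f (H lam) (Set.Ioi 0) ∧ c = d lam) ∧
      -- construction from the Airy function and the Volterra fixed point
      (∀ s : ℝ, s₀ ≤ s → FokkerPlanckAiry.airyG lam s ≠ 0) ∧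
      FokkerPlanckAiry.IsVolterraFixedPoint γ lam s₀ (R lam) ∧
      (∀ Q : ℝ → ℂ, FokkerPlanckAiry.IsVolterraFixedPoint γ lam s₀ Q →
        ∀ᵐ s ∂(MeasureTheory.volume.restrict (Set.Ici s₀)), Q s = R lam s) ∧
      ∃ C : ℂ, C ≠ 0 ∧ ∀ s : ℝ, s₀ ≤ s →
        H lam s = C * FokkerPlanckAiry.airyG lam s * (1 + R lam s) := by
  have hκ : 0 ≤ γ * (γ + 1) := by positivity
  -- The value $100$ serves the energy estimates ($\sqrt s\ge10$), and $4\gamma(\gamma+1)$ gives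
  -- contraction factor $1/4$. The final $s_0=a+2$ places the closed half-line inside
  -- $(a+1,\infty)$, where the differential equation for $Gy$ is available.
  set a := max 100 (4 * (γ * (γ + 1))) with ha_def
  have ha : 100 ≤ a := le_max_left _ _
  have hκa : 4 * (γ * (γ + 1)) ≤ a := le_max_right _ _
  have ha0 : 0 < a := by linarith
  suffices key : ∀ lam : ℂ, ∃ (d : ℂ) (H R : ℝ → ℂ), ‖lam‖ ≤ 1 / 4 →
      IsNormalizedL2Solution γ lam H d ∧
      (∀ (f : ℝ → ℂ) (c : ℂ), IsNormalizedL2Solution γ lam f c →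
        Set.EqOn f H (Set.Ioi 0) ∧ c = d) ∧
      (∀ s : ℝ, a + 2 ≤ s → airyG lam s ≠ 0) ∧
      IsVolterraFixedPoint γ lam (a + 2) R ∧
      (∀ Q : ℝ → ℂ, IsVolterraFixedPoint γ lam (a + 2) Q →
        ∀ᵐ s ∂(MeasureTheory.volume.restrict (Set.Ici (a + 2))), Q s = R s) ∧
      ∃ C : ℂ, C ≠ 0 ∧ ∀ s : ℝ, a + 2 ≤ s → H s = C * airyG lam s * (1 + R s) by
    choose d H R h using key
    exact ⟨1 / 4, by norm_num, a + 2, by linarith, d, H, R, h⟩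
  intro lam
  by_cases hlam : ‖lam‖ ≤ 1 / 4
  swap
  -- Outside the disc the choice functions take the junk value $0$.
  · exact ⟨0, 0, 0, fun h => absurd h hlam⟩
  have hG := decayingOn_airyG hlam ha
  obtain ⟨y, hy, ⟨M, hM⟩, hfix⟩ := exists_volterra_solution hG ha0 hκ hκa
  have hb : 0 ≤ a + 1 := by linarith
  obtain ⟨h', C, hsol, hC, hne⟩ :=
    solvesOn_airyG_mul hγ hlam (ha.trans (by linarith : a ≤ a + 1)) hy hM hfix
  obtain ⟨α, β, hexp, hW⟩ := exists_frobenius_expansion hγ hres hb hsol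
  have hα := frobenius_component_ne_zero hγ hres hlam hb hC hne hexp
  obtain ⟨hp, hm⟩ := frobenius_exponent_ne hγ hres
  have h₁ := frobeniusSol_solvesOn (γ := γ) hp (by ring) lam
  have h₂ := frobeniusSol_solvesOn (γ := γ) hm (by ring) lam
  have hH := h₁.add_const_mul h₂ (β / α)
  set H : ℝ → ℂ := fun s => frobeniusSol (-γ) lam s + β / α * frobeniusSol (γ + 1) lam s with hHdef
  -- The Frobenius combination continues the normalised decaying solution from the neighbourhood of
  -- infinity to all of $(0,\infty)$.
  have hHG : ∀ s, a + 1 < s → H s = α⁻¹ * (airyG lam s * y s) := fun s hs => by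
    rw [(hexp s hs).1]
    simp only [hHdef]
    field_simp
  have hL2 : IsNormalizedL2Solution γ lam H (β / α) := by
    refine ⟨hH.isModelSolution, ?_, fun s _ => ?_⟩
    · refine sq_integrableOn_of_norm_le_exp (b := a + 1) (C := ‖α⁻¹‖ * C)
        (fun s hs => (hH s hs).1.continuousAt.continuousWithinAt) fun s hs => ?_
      rw [hHG s hs, norm_mul, mul_assoc]
      gcongr
      exact (hC s hs).1
    · simp only [hHdef, frobeniusSol, Fplus, Fminus]
      ring
  have hnot : ¬ MeasureTheory.IntegrableOn (fun s => ‖frobeniusSol (γ + 1) lam s‖ ^ 2)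
      (Set.Ici 1) := fun hint => by
    have hw : α * (2 * (γ : ℂ) + 1) ≠ 0 := by
      refine mul_ne_zero hα ?_
      have : 2 * γ + 1 ≠ 0 := by linarith
      exact_mod_cast this
    refine not_sq_integrableOn_of_wronskian_ne_zero hb hsol (h₂.mono (Set.Ioi_subset_Ioi hb)) hC hw
      hW (lt_add_one (a + 1)) (hint.mono_set fun s hs => ?_)
    have : a + 1 + 1 < s := hs
    exact Set.mem_Ici.2 (by linarith)
  have hR : IsVolterraFixedPoint γ lam (a + 2) (fun s => y s - 1) := by
    refine ⟨MeasureTheory.memLp_top_of_bound (hy.sub continuous_const).aestronglyMeasurable (M + 1)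
      (Filter.Eventually.of_forall fun s => (norm_sub_le _ _).trans (by simpa using hM s)), ?_⟩
    filter_upwards [MeasureTheory.ae_restrict_mem measurableSet_Ici] with s hs
    have hs' : a + 2 ≤ s := hs
    have has : a < s := by linarith
    simp only [add_sub_cancel]
    refine ⟨integrableOn_decayKernel_mul hG ha0 hκ hy hM has, ?_⟩
    rw [hfix s (by linarith), add_sub_cancel_left]
    exact (integral_decayKernel_mul hG ha0 hκ hy hM has).symm
  refine ⟨β / α, H, fun s => y s - 1, fun _ => ⟨hL2, fun f c hf => hf.unique hL2
    (fun s hs => (h₂ s hs).1.continuousAt.continuousWithinAt) hnot,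
    fun s hs => hG.ne_zero s (by linarith), hR, fun Q hQ => hQ.ae_eq hκ (by linarith)
      (by linarith) (decayingOn_airyG hlam (by linarith)) hR, α⁻¹, inv_ne_zero hα, fun s hs => ?_⟩⟩
  rw [hHG s (by linarith), add_sub_cancel, mul_assoc]
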